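/- Setting. Let $\Sigma^+\subset \mathcal W_1^{\{0,1,2,\dots\}}$ be a compact one-sided Markov shift over a countable alphabet $\mathcal W_1$ (each letter of which occurs in $\Sigma^+$), with shift $\sigma$ topologically mixing. Let $R:\Sigma^+\to(0,\infty)$ with $\log R$ locally Hölder continuous and Gurevič pressure $P(\log R,\sigma)=0$; write $R_n(x)=\prod_{i<n}R(\sigma^i x)$. Let $G$ be a countable discrete group and $\mathfrak s:\mathcal W_1\to G$ a map such that the skew product $T_{\mathfrak s}(x,g)=(\sigma x,\mathfrak s(x_0)^{-1}g)$ on $\Sigma^+\times G$ is topologically transitive; for a word put $\underline{\mathfrak s}(w_1\cdots w_n)=\mathfrak s(w_1)\cdots\mathfrak s(w_n)$. Let $\rho$ be the unitary representation of $G$ by translations in $\mathcal H=\bigoplus_{i\in I}\ell^2(G/H_i,\mathbb R)$, where $I$ is countable and the $H_i\le G$ are subgroups, and let $\mathcal H_+$ be the cone of non-negative functions. Fix letters $A,a$, a point $x^{0}\in\sigma[a]$ and $0\ne f\in\mathcal H_+$. For $c:\mathbb N\to(0,\infty)$, $t>0$ and $N\in\mathbb N\cup\{\infty\}$ put $$\phi_{c;\le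 N}[t](g)=\sum_{n=1}^{N}t^{-n}c_n\sum_{w}R_n(wx^{0}),$$ the inner sum being over the admissible words $w$ of length $n$ with first letter $A$, last letter $a$ and $\underline{\mathfrak s}(w)=g$. Write $\phi_c=\phi_{c;\le\infty}$, $\phi_{\le N}=\phi_{1;\le N}$, $\varphi\ast_\rho f=\sum_{h\in G}\varphi(h)\rho(h)f$, and $$\gamma=\gamma(\phi\ast_\rho f)=\inf\Big\{t>0:\ \sup_{N\in\mathbb N}\|\phi_{\le N}[t]\ast_\rho f\|^2<\infty\Big\}.$$ Call $(c,(t_k),\Upsilon_c,\nu_c)$ *admissible data* if (i) $c$ is slowly increasing, i.e. positive, non-decreasing, with $c_{n+k}/c_n\to1$ as $n\to\infty$ for every $k$, and $\|\phi_c[t]\ast_\rho f\|\to\infty$ as $t\downarrow\gamma$; (ii) $t_k>\gamma$ and $t_k\to\gamma$; (iii) with $Q_k=\phi_c[t_k]\ast_\rho f$, for every $g\in G$ $$\Upsilon_c(g)=\lim_{k\to\infty}\frac{\langle\rho(g)Q_k,Q_k\rangle}{\langle Q_k,Q_k\rangle};$$ (iv) $\nu_c$ is a finite Borel measure on $\Sigma^+$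 that is the weak-$*$ limit, as $k\to\infty$, of the weighted sums of Dirac masses $$\sum_{n\ge1}t_k^{-n}c_n\sum_{v}R_n(vx^{0})\,\frac{\langle\rho(\underline{\mathfrak s}(v))f,Q_k\rangle}{\langle Q_k,Q_k\rangle}\,\delta_{vx^{0}},$$ where $v$ runs over the admissible words of length $n$ with last letter $a$ (and any first letter). Statement. Suppose that $\gamma=\gamma(\phi\ast_\rho f)<1$. Then admissible data exist, and for all admissible data $(c,(t_k),\Upsilon_c,\nu_c)$ the following hold. 1. For every $\epsilon\in(0,1)$ and every $v\in\mathcal H_+$, for $\nu_c$-almost every $x\in\Sigma^+$ there is $N$ such that $$n\ge N\ \Longrightarrow\ \langle\rho(\underline{\mathfrak s}(x_1\cdots x_n))f,v\rangle\le(1-\epsilon)^{-n}\,\Upsilon_c(\underline{\mathfrak s}(x_1\cdots x_n)).$$ 2. For $\nu_c$-almost every $x\in\Sigma^+$ there is $N$ such that $$n\ge N\ \Longrightarrow\ \Upsilon_c(\underline{\mathfrak s}(x_1\cdots x_n))\ge n^{-2}\,\gamma^n.$$ Both statements also hold with $x_0\cdots x_{n-1}$, the first $n$ letters of $x=(x_0,x_1,\dots)$,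 in place of $x_1\cdots x_n$. -/

import Mathlib

open MeasureTheory Filter Topology
open scoped ENNReal

namespace TwistedDecay

noncomputable section

/-! ### One-sided Markov shifts -/

/-- The one-sided Markov shift `Σ⁺` with alphabet `W` and transition relation `τ`. When `W` is
discrete, the topology (and σ-algebra) inherited from `ℕ → W` is generated by the cylinders. -/
abbrev MarkovShift {W : Type*} (τ : W → W → Prop) : Type _ :=
  {x : ℕ → W // ∀ i, τ (x i) (x (i + 1))}

section Shift

variable {W : Type*} {τ : W → W → Prop}

/-- The left shift `σ`. -/
def shift (x : MarkovShift τ) : MarkovShift τ :=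
  ⟨fun i => x.1 (i + 1), fun i => x.2 (i + 1)⟩

/-- `R_n(x) = R(x) R(σ x) ⋯ R(σ^{n-1} x)`. -/
def birkhoffProd (R : MarkovShift τ → ℝ) (n : ℕ) (x : MarkovShift τ) : ℝ :=
  ∏ i ∈ Finset.range n, R (shift^[i] x)

/-- Topological mixing of `σ : Σ⁺ → Σ⁺`. -/
def IsMixing [TopologicalSpace W] (τ : W → W → Prop) : Prop :=
  ∀ U V : Set (MarkovShift τ), IsOpen U → IsOpen V → U.Nonempty → V.Nonempty →
    ∃ N, ∀ n ≥ N, (shift^[n] '' U ∩ V).Nonempty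

/-- Local Hölder continuity: the variation over points that share their first `n` letters is at
most `C θ ^ n`, for all `n > 1`. -/
def LocallyHolder (r : MarkovShift τ → ℝ) : Prop :=
  ∃ C θ : ℝ, 0 < θ ∧ θ < 1 ∧ ∀ n : ℕ, 1 < n → ∀ x y : MarkovShift τ,
    (∀ i < n, x.1 i = y.1 i) → |r x - r y| ≤ C * θ ^ n

/-- The Gurevič pressure `P(log R, σ)`, computed with periodic points in the cylinder `[B]`. -/
def gurevicPressure (R : MarkovShift τ → ℝ) (B : W) : EReal :=
  limsup (fun n : ℕ =>
    ENNReal.log (∑' y : {y : MarkovShift τ // y.1 0 = B ∧ shift^[n] y = y},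
      ENNReal.ofReal (birkhoffProd R n y.1)) / (n : EReal)) atTop

variable {G : Type*} [Group G]

/-- The skew product `T_s(x, g) = (σ x, s(x₀)⁻¹ g)` on `Σ⁺ × G`. -/
def skewProduct (s : W → G) (p : MarkovShift τ × G) : MarkovShift τ × G :=
  (shift p.1, (s (p.1.1 0))⁻¹ * p.2)

/-- Topological transitivity of `T_s`, where `G` is discrete. -/
def IsTransitiveSkew [TopologicalSpace W] (τ : W → W → Prop) (s : W → G) : Prop :=
  ∀ U V : Set (MarkovShift τ), IsOpen U → IsOpen V → U.Nonempty → V.Nonempty →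
    ∀ g h : G, ∃ n : ℕ,
      ((skewProduct (τ := τ) s)^[n] '' (U ×ˢ {g}) ∩ (V ×ˢ {h})).Nonempty

/-- The group element `s(y_j) s(y_{j+1}) ⋯ s(y_{j+n-1})`. -/
def wordValue (s : W → G) (y : MarkovShift τ) (j n : ℕ) : G :=
  (List.ofFn fun i : Fin n => s (y.1 (j + i))).prod

end Shift

/-! ### Countable direct sums of quotient representations -/

section Representation

variable {G : Type*} [Group G] {I : Type*}

/-- The Hilbert space `⨁ᵢ ℓ²(G/Hᵢ)` (real scalars), realised as `ℓ²` of the disjoint union of the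
coset spaces. -/
abbrev QuotientSum (H : I → Subgroup G) : Type _ :=
  lp (fun _ : (Σ i, G ⧸ H i) => ℝ) 2

variable {H : I → Subgroup G}

theorem memlp_translate (g : G) (f : QuotientSum H) :
    Memℓp (fun p : (Σ i, G ⧸ H i) => f (g⁻¹ • p)) 2 := by
  have h2 : 0 < (2 : ℝ≥0∞).toReal := by norm_num
  have hf := (memℓp_gen_iff h2).1 (lp.memℓp f)
  exact (memℓp_gen_iff h2).2 (hf.comp_injective (MulAction.injective (g⁻¹ : G)))

/-- The operator `[ρ(g) f](p) = f(g⁻¹ p)`. -/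
def translate (g : G) (f : QuotientSum H) : QuotientSum H :=
  ⟨fun p => f (g⁻¹ • p), memlp_translate g f⟩

theorem translate_apply (g : G) (f : QuotientSum H) (p : Σ i, G ⧸ H i) :
    translate g f p = f (g⁻¹ • p) := rfl

theorem norm_translate (g : G) (f : QuotientSum H) : ‖translate g f‖ = ‖f‖ := by
  have h2 : 0 < (2 : ℝ≥0∞).toReal := by norm_num
  rw [lp.norm_eq_tsum_rpow h2, lp.norm_eq_tsum_rpow h2]
  congr 1
  exact (MulAction.toPerm (g⁻¹ : G)).tsum_eq (fun p => ‖f p‖ ^ (2 : ℝ≥0∞).toReal)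

theorem translate_mul (g h : G) (f : QuotientSum H) :
    translate (g * h) f = translate g (translate h f) := by
  ext p
  simp only [translate_apply, mul_inv_rev, mul_smul]

theorem translate_one (f : QuotientSum H) : translate 1 f = f := by
  ext p
  simp only [translate_apply, inv_one, one_smul]

/-- The unitary representation `ρ = ⨁ᵢ λ_{Hᵢ}` of `G` in `⨁ᵢ ℓ²(G/Hᵢ)`. -/
def rho (H : I → Subgroup G) : G →* (QuotientSum H ≃ₗᵢ[ℝ] QuotientSum H) where
  toFun g :=
    { toFun := translate g
      invFun := translate g⁻¹
      left_inv := fun f => by rw [← translate_mul, inv_mul_cancel, translate_one]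
      right_inv := fun f => by rw [← translate_mul, mul_inv_cancel, translate_one]
      map_add' := fun f f' => by ext p; rfl
      map_smul' := fun r f => by ext p; rfl
      norm_map' := norm_translate g }
  map_one' := by ext1 f; exact translate_one f
  map_mul' g h := by ext1 f; exact translate_mul g h f

/-- Membership in the cone `𝓗₊` of non-negative functions. -/
def InCone (f : QuotientSum H) : Prop := ∀ p, 0 ≤ f p

/-- `φ ∗_ρ f = ∑_h φ(h) ρ(h) f`. -/
def conv (φ : G → ℝ) (f : QuotientSum H) : QuotientSum H :=
  ∑' h : G, φ h • rho H h f

end Representation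

/-! ### Thermodynamic `G`-densities -/

section Density

variable {W : Type*} {τ : W → W → Prop} {G : Type*} [Group G]

/-- The summand of index `n ≥ 1` of the thermodynamic `G`-density:
`t⁻ⁿ c_n ∑ R_n(wx)` over the admissible words `w` of length `n` with first letter `A`, last letter
`a` and `s(w) = g`. For `x ∈ σ[a]` these words correspond, through `y = wx`, to the points `y` of
`Σ⁺` with `σⁿ y = x`, `y₀ = A`, `y_{n-1} = a`. -/
def phiTerm (R : MarkovShift τ → ℝ) (s : W → G) (A a : W) (x : MarkovShift τ)
    (c : ℕ → ℝ) (t : ℝ) (n : ℕ) (g : G) : ℝ :=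
  (t ^ n)⁻¹ * c n *
    ∑' y : {y : MarkovShift τ //
        shift^[n] y = x ∧ y.1 0 = A ∧ y.1 (n - 1) = a ∧ wordValue s y 0 n = g},
      birkhoffProd R n y.1

/-- The partial sums `φ^{A,a}_{c;≤N}[t]`. -/
def phiPartial (R : MarkovShift τ → ℝ) (s : W → G) (A a : W) (x : MarkovShift τ)
    (c : ℕ → ℝ) (N : ℕ) (t : ℝ) (g : G) : ℝ :=
  ∑ n ∈ Finset.Icc 1 N, phiTerm R s A a x c t n g

/-- The thermodynamic `G`-density `φ^{A,a}_c[t]`. -/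
def phi (R : MarkovShift τ → ℝ) (s : W → G) (A a : W) (x : MarkovShift τ)
    (c : ℕ → ℝ) (t : ℝ) (g : G) : ℝ :=
  ∑' n : ℕ, phiTerm R s A a x c t (n + 1) g

variable {I : Type*} {H : I → Subgroup G}

/-- The decay exponent `γ(φ ∗_ρ f)`. -/
def decayExponent (R : MarkovShift τ → ℝ) (s : W → G) (A a : W) (x : MarkovShift τ)
    (f : QuotientSum H) : ℝ :=
  sInf {t : ℝ | 0 < t ∧ BddAbove (Set.range fun N : ℕ =>
    inner ℝ (conv (phiPartial R s A a x (fun _ => 1) N t) f)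
      (conv (phiPartial R s A a x (fun _ => 1) N t) f))}

/-- Slowly increasing functions `c : ℕ → (0, ∞)`. -/
structure SlowlyIncreasing (c : ℕ → ℝ) : Prop where
  pos : ∀ n, 0 < c n
  mono : Monotone c
  slow : ∀ k : ℕ, Tendsto (fun n => c (n + k) / c n) atTop (𝓝 1)

/-- The vector `φ_c[t] ∗_ρ f`. -/
def phiVec (R : MarkovShift τ → ℝ) (s : W → G) (A a : W) (x : MarkovShift τ)
    (f : QuotientSum H) (c : ℕ → ℝ) (t : ℝ) : QuotientSum H :=
  conv (phi R s A a x c t) f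

/-- The normalised matrix coefficient
`⟨ρ(g) φ_c[t] ∗ f, φ_c[t] ∗ f⟩ / ⟨φ_c[t] ∗ f, φ_c[t] ∗ f⟩`. -/
def matrixCoeff (R : MarkovShift τ → ℝ) (s : W → G) (A a : W) (x : MarkovShift τ)
    (f : QuotientSum H) (c : ℕ → ℝ) (t : ℝ) (g : G) : ℝ :=
  inner ℝ (rho H g (phiVec R s A a x f c t)) (phiVec R s A a x f c t) /
    inner ℝ (phiVec R s A a x f c t) (phiVec R s A a x f c t)

/-- The weighted sum of Dirac masses
`ν_c[t] = ∑_{n ≥ 1} t⁻ⁿ c_n ∑_v R_n(vx) (⟨ρ(s(v)) f, Q⟩ / ⟨Q, Q⟩) D(vx)`, `Q = φ_c[t] ∗_ρ f`,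
the inner sum being over the admissible words `v` of length `n` with last letter `a` (and any first
letter), that is, over the points `y = vx` with `σⁿ y = x` and `y_{n-1} = a`. -/
def approxMeasure [MeasurableSpace W] (R : MarkovShift τ → ℝ) (s : W → G) (A a : W)
    (x : MarkovShift τ) (f : QuotientSum H) (c : ℕ → ℝ) (t : ℝ) : Measure (MarkovShift τ) :=
  Measure.sum fun n : ℕ =>
    Measure.sum fun y : {y : MarkovShift τ // shift^[n + 1] y = x ∧ y.1 n = a} =>
      ENNReal.ofReal ((t ^ (n + 1))⁻¹ * c (n + 1) * birkhoffProd R (n + 1) y.1 *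
        (inner ℝ (rho H (wordValue s y.1 0 (n + 1)) f) (phiVec R s A a x f c t) /
          inner ℝ (phiVec R s A a x f c t) (phiVec R s A a x f c t))) •
      Measure.dirac y.1

/-- `(Υ, ν)` is a pair `(Υ_c, ν_c^{φ ∗_ρ f})` obtained from a slowly increasing `c` that makes
`‖φ_c[t] ∗_ρ f‖` diverge at the decay exponent, along a sequence `t_k` decreasing to that exponent:
`Υ` is the pointwise limit of the normalised matrix coefficients, and `ν` the weak-* limit of the
measures `ν_c[t_k]`. -/
structure IsTwistedLimit [TopologicalSpace W] [MeasurableSpace W]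
    (R : MarkovShift τ → ℝ) (s : W → G) (A a : W) (x : MarkovShift τ) (f : QuotientSum H)
    (c : ℕ → ℝ) (t : ℕ → ℝ) (Υ : G → ℝ) (ν : Measure (MarkovShift τ)) : Prop where
  slowlyIncreasing : SlowlyIncreasing c
  diverges : Tendsto
    (fun u : ℝ => inner ℝ (phiVec R s A a x f c u) (phiVec R s A a x f c u))
    (𝓝[>] (decayExponent R s A a x f)) atTop
  lt_param : ∀ k, decayExponent R s A a x f < t k
  tendsto_param : Tendsto t atTop (𝓝 (decayExponent R s A a x f))
  tendsto_coeff : ∀ g, Tendsto (fun k => matrixCoeff R s A a x f c (t k) g) atTop (𝓝 (Υ g))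
  finite : IsFiniteMeasure ν
  tendsto_measure : ∀ F : C(MarkovShift τ, ℝ),
    Tendsto (fun k => ∫ z, F z ∂(approxMeasure R s A a x f c (t k))) atTop (𝓝 (∫ z, F z ∂ν))

end Density

end

end TwistedDecay

open TwistedDecay

/-!
Let `Q = φ_c[t] ∗_ρ f`. Its square norm is a series of non-negative terms indexed by pairs of
inverse branches of `σ`, which makes every estimate a comparison of such series. Because `c` is
slowly increasing, removing the first `n` letters of all long branches in the cylinder of
`z₀ ⋯ z_{n-1}` bounds the `ν_c[t]`-mass of that cylinder by a constant times
`t⁻ⁿ R_n(z) ⟨ρ(s(z₀ ⋯ z_{n-1})) Q, Q⟩ / ⟨Q, Q⟩`, up to an error of order `‖Q‖⁻¹` coming from the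
finitely many short branches; transitivity of the skew product is what lets branches with an
arbitrary first letter be compared with those counted in `Q`. Since `‖Q‖ → ∞` as `t ↓ γ`, in the
limit `ν(cylinder z n) ≤ C γ⁻ⁿ R_n(z) Υ(s(z₀ ⋯ z_{n-1}))`.

Hence the set where `Υ < ψ n` has measure at most `C ∑_u γ⁻ⁿ R_n(u) ψ n (s(u))`, and Borel–Cantelli
applies as soon as these sums are summable in `n`. For `ψ n g = (1 - ε)ⁿ ⟨ρ(g) f, v⟩` the double sum
is a pairing of `φ[γ / (1 - ε)] ∗_ρ f` with `v`, up to constants, and is finite by the definition of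
`γ`; for `ψ n g = n⁻² γⁿ` it is controlled by `∑_u R_n(u)`, which is bounded because the pressure
vanishes.

For the existence, `c` is a slowly increasing weight growing fast enough to make the series
diverge at `γ`, and the limits are extracted by compactness.
-/

namespace TwistedDecay

noncomputable section

/-! ### Words of the shift -/

section Words

variable {W : Type*} {τ : W → W → Prop}

theorem shift_iterate_apply (k : ℕ) (y : MarkovShift τ) (i : ℕ) :
    (shift^[k] y).1 i = y.1 (i + k) := by
  induction k generalizing y with
  | zero => rfl
  | succ k ih => rw [Function.iterate_succ_apply, ih, shift]; congr 1

theorem ext_of_prefix_of_shift {y z : MarkovShift τ} (k : ℕ) (h : ∀ i < k, y.1 i = z.1 i)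
    (hs : shift^[k] y = shift^[k] z) : y = z := by
  ext i
  rcases lt_or_ge i k with hi | hi
  · exact h i hi
  · simpa [shift_iterate_apply, Nat.sub_add_cancel hi] using
      congrArg (fun u : MarkovShift τ => u.1 (i - k)) hs

/-- The point `p₀ ⋯ p_{k-1} y`. The transition at the junction is admissible because
`p_k = y₀`. -/
def glue (p : MarkovShift τ) (k : ℕ) (y : MarkovShift τ) (h : p.1 k = y.1 0) : MarkovShift τ :=
  ⟨fun i => if i < k then p.1 i else y.1 (i - k), fun i => by
    rcases lt_trichotomy (i + 1) k with hi | hi | hi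
    · simpa [hi, (Nat.lt_succ_self i).trans hi] using p.2 i
    · have := p.2 i
      rw [hi, h] at this
      simpa [hi, show i < k by omega] using this
    · have := y.2 (i - k)
      rw [show i - k + 1 = i + 1 - k by omega] at this
      simpa [show ¬ i < k by omega, show ¬ i + 1 < k by omega] using this⟩

theorem glue_apply_of_le {p y : MarkovShift τ} {k : ℕ} (h : p.1 k = y.1 0) {i : ℕ} (hi : i ≤ k) :
    (glue p k y h).1 i = p.1 i := by
  rcases hi.lt_or_eq with hi | rfl
  · exact if_pos hi
  · simp [glue, h]

theorem glue_apply_add {p y : MarkovShift τ} {k : ℕ} (h : p.1 k = y.1 0) (i : ℕ) :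
    (glue p k y h).1 (i + k) = y.1 i := by
  simp [glue]

theorem shift_iterate_glue {p y : MarkovShift τ} {k : ℕ} (h : p.1 k = y.1 0) :
    shift^[k] (glue p k y h) = y := by
  ext i
  rw [shift_iterate_apply, glue_apply_add]

/-- The periodic point with period word `y₀ ⋯ y_{n-1}`. -/
def periodize (y : MarkovShift τ) (n : ℕ) (hn : 0 < n) (h : y.1 n = y.1 0) : MarkovShift τ :=
  ⟨fun i => y.1 (i % n), fun i => by
    beta_reduce
    rcases Nat.lt_or_ge (i % n + 1) n with hi | hi
    · rw [Nat.add_mod i, Nat.mod_eq_of_lt (a := 1) (by omega), Nat.mod_eq_of_lt hi]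
      exact y.2 _
    · have hlast : i % n + 1 = n := by have := Nat.mod_lt i hn; omega
      have hnext : (i + 1) % n = 0 := by rw [← Nat.mod_add_mod, hlast, Nat.mod_self]
      simpa only [hnext, ← h, hlast] using y.2 (i % n)⟩

theorem periodize_apply_of_le {y : MarkovShift τ} {n : ℕ} (hn : 0 < n) (h : y.1 n = y.1 0) {i : ℕ}
    (hi : i ≤ n) : (periodize y n hn h).1 i = y.1 i := by
  rcases hi.lt_or_eq with hi | rfl
  · simp [periodize, Nat.mod_eq_of_lt hi]
  · simp [periodize, h]

theorem shift_iterate_periodize {y : MarkovShift τ} {n : ℕ} (hn : 0 < n) (h : y.1 n = y.1 0) :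
    shift^[n] (periodize y n hn h) = periodize y n hn h := by
  ext i
  rw [shift_iterate_apply]
  simp [periodize]

theorem eq_of_shift_iterate_eq_self {y z : MarkovShift τ} {n : ℕ} (hn : 0 < n)
    (hy : shift^[n] y = y) (hz : shift^[n] z = z) (h : ∀ i < n, y.1 i = z.1 i) : y = z := by
  ext i
  induction i using Nat.strong_induction_on with
  | _ i ih =>
    rcases lt_or_ge i n with hi | hi
    · exact h i hi
    · have hy' := shift_iterate_apply n y (i - n)
      have hz' := shift_iterate_apply n z (i - n)
      rw [hy, Nat.sub_add_cancel hi] at hy'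
      rw [hz, Nat.sub_add_cancel hi] at hz'
      rw [← hy', ← hz']
      exact ih _ (by omega)

/-- The cylinder `[z₀ ⋯ z_{n-1}]`, the word being read off a point `z` of the shift. -/
def cylinder (z : MarkovShift τ) (n : ℕ) : Set (MarkovShift τ) :=
  {y | ∀ i < n, y.1 i = z.1 i}

theorem cylinder_anti (z : MarkovShift τ) {k n : ℕ} (h : k ≤ n) : cylinder z n ⊆ cylinder z k :=
  fun _ hy i hi => hy i (hi.trans_le h)

theorem shift_iterate_mem_cylinder {y z : MarkovShift τ} {k n : ℕ} (h : y ∈ cylinder z (k + n)) :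
    shift^[k] y ∈ cylinder (shift^[k] z) n := fun i hi => by
  rw [shift_iterate_apply, shift_iterate_apply]
  exact h _ (by omega)

section Topology

variable [TopologicalSpace W] [DiscreteTopology W]

theorem isClopen_cylinder (z : MarkovShift τ) (n : ℕ) : IsClopen (cylinder z n) := by
  have hcyl : cylinder z n = ⋂ i ∈ Set.Iio n, (fun y : MarkovShift τ => y.1 i) ⁻¹' {z.1 i} := by
    ext y; simp [cylinder]
  rw [hcyl]
  exact (Set.finite_Iio n).isClopen_biInter fun i _ =>
    (isClopen_discrete _).preimage ((continuous_apply i).comp continuous_subtype_val)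

theorem isOpen_setOf_head_eq (B : W) : IsOpen {y : MarkovShift τ | y.1 0 = B} :=
  (isOpen_discrete ({B} : Set W)).preimage
    (f := fun y : MarkovShift τ => y.1 0) ((continuous_apply 0).comp continuous_subtype_val)

theorem finite_alphabet [CompactSpace (MarkovShift τ)]
    (hlive : ∀ B : W, ∃ y : MarkovShift τ, y.1 0 = B) : Finite W := by
  have hcont : Continuous (fun y : MarkovShift τ => y.1 0) :=
    (continuous_apply 0).comp continuous_subtype_val
  have hrange : IsCompact (Set.range (fun y : MarkovShift τ => y.1 0)) := isCompact_range hcont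
  rw [Set.range_eq_univ.2 hlive] at hrange
  exact Set.finite_univ_iff.1 (hrange.finite_of_discrete)

end Topology

end Words

section WordValue

variable {W : Type*} {τ : W → W → Prop} {G : Type*} [Group G] (s : W → G)

theorem wordValue_zero (y : MarkovShift τ) (j : ℕ) : wordValue s y j 0 = 1 := rfl

theorem wordValue_shift_iterate (y : MarkovShift τ) (j n : ℕ) :
    wordValue s (shift^[j] y) 0 n = wordValue s y j n := by
  simp only [wordValue, shift_iterate_apply, Nat.zero_add, Nat.add_comm _ j]

theorem wordValue_succ (y : MarkovShift τ) (n : ℕ) :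
    wordValue s y 0 (n + 1) = s (y.1 0) * wordValue s (shift y) 0 n := by
  simp [wordValue, List.ofFn_succ, shift]

theorem wordValue_add (y : MarkovShift τ) (k n : ℕ) :
    wordValue s y 0 (k + n) = wordValue s y 0 k * wordValue s (shift^[k] y) 0 n := by
  induction k generalizing y with
  | zero => simp [wordValue_zero]
  | succ k ih =>
    rw [show k + 1 + n = k + n + 1 by omega, wordValue_succ, ih, wordValue_succ, mul_assoc]
    rfl

theorem wordValue_congr {y z : MarkovShift τ} {j n : ℕ} (h : y ∈ cylinder z (j + n)) :
    wordValue s y j n = wordValue s z j n := by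
  unfold wordValue
  congr 2
  funext i
  rw [h _ (by omega)]

theorem skewProduct_iterate (n : ℕ) (y : MarkovShift τ) (g : G) :
    (skewProduct s)^[n] (y, g) = (shift^[n] y, (wordValue s y 0 n)⁻¹ * g) := by
  induction n generalizing y g with
  | zero => simp [wordValue_zero]
  | succ n ih =>
    rw [Function.iterate_succ_apply, wordValue_succ, skewProduct, ih]
    simp [mul_assoc]

/-- Combinatorial transitivity of the skew product: any two letters `B`, `E` are joined by a word
of prescribed value `g`. The word is `p₀ ⋯ p_{k-1}`, and it is followed by `p_k = E`. -/
def WordsConnect (τ : W → W → Prop) (s : W → G) : Prop :=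
  ∀ (B E : W) (g : G), ∃ (p : MarkovShift τ) (k : ℕ),
    p.1 0 = B ∧ p.1 k = E ∧ wordValue s p 0 k = g

theorem IsTransitiveSkew.wordsConnect [TopologicalSpace W] [DiscreteTopology W] {s : W → G}
    (htrans : IsTransitiveSkew τ s) (hlive : ∀ B : W, ∃ y : MarkovShift τ, y.1 0 = B) :
    WordsConnect τ s := by
  intro B E g
  obtain ⟨n, _, ⟨⟨y, g'⟩, ⟨hy, hg'⟩, rfl⟩, hE, hvalue⟩ :=
    htrans _ _ (isOpen_setOf_head_eq B) (isOpen_setOf_head_eq E) (hlive B) (hlive E) g 1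
  rw [skewProduct_iterate] at hE hvalue
  obtain rfl : g' = g := hg'
  refine ⟨y, n, hy, ?_, inv_mul_eq_one.1 hvalue⟩
  simpa only [Set.mem_ofPred_eq, shift_iterate_apply, Nat.zero_add] using hE

theorem WordsConnect.countable [Countable W] [Nonempty W] {s : W → G} (hs : WordsConnect τ s) :
    Countable G := by
  have hsurj : Function.Surjective fun l : List W => (l.map s).prod := fun g => by
    obtain ⟨B⟩ := ‹Nonempty W›
    obtain ⟨p, k, -, -, hg⟩ := hs B B g
    exact ⟨List.ofFn fun i : Fin k => p.1 (0 + i), (congrArg List.prod List.map_ofFn).trans hg⟩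
  exact hsurj.countable

end WordValue

/-! ### Birkhoff products -/

section BirkhoffProd

variable {W : Type*} {τ : W → W → Prop} {R : MarkovShift τ → ℝ}

theorem birkhoffProd_add (R : MarkovShift τ → ℝ) (k n : ℕ) (y : MarkovShift τ) :
    birkhoffProd R (k + n) y = birkhoffProd R k y * birkhoffProd R n (shift^[k] y) := by
  rw [birkhoffProd, Finset.prod_range_add]
  congr 1
  refine Finset.prod_congr rfl fun i _ => ?_
  rw [← Function.iterate_add_apply, add_comm]

theorem birkhoffProd_succ (R : MarkovShift τ → ℝ) (n : ℕ) (y : MarkovShift τ) :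
    birkhoffProd R (n + 1) y = R y * birkhoffProd R n (shift y) := by
  rw [birkhoffProd, Finset.prod_range_succ', mul_comm]
  rfl

theorem birkhoffProd_pos (hR : ∀ y, 0 < R y) (n : ℕ) (y : MarkovShift τ) :
    0 < birkhoffProd R n y :=
  Finset.prod_pos fun _ _ => hR _

theorem pow_le_birkhoffProd {r : ℝ} (hr : 0 ≤ r) (hR : ∀ y, r ≤ R y) (n : ℕ)
    (y : MarkovShift τ) : r ^ n ≤ birkhoffProd R n y := by
  simpa [birkhoffProd] using Finset.prod_le_prod (s := Finset.range n) (f := fun _ => r)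
    (fun _ _ => hr) fun i _ => hR (shift^[i] y)

theorem birkhoffProd_le_pow {r : ℝ} (hR0 : ∀ y, 0 ≤ R y) (hR : ∀ y, R y ≤ r) (n : ℕ)
    (y : MarkovShift τ) : birkhoffProd R n y ≤ r ^ n := by
  simpa [birkhoffProd] using Finset.prod_le_prod (s := Finset.range n) (g := fun _ => r)
    (fun i _ => hR0 (shift^[i] y)) fun i _ => hR (shift^[i] y)

/-- Bounded distortion with constant `D`: on every cylinder of length `n`, the values of `R_n`
differ by a factor of at most `D`. -/
def HasDistortion (R : MarkovShift τ → ℝ) (D : ℝ) : Prop :=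
  ∀ (n : ℕ) (y z : MarkovShift τ), y ∈ cylinder z n → birkhoffProd R n y ≤ D * birkhoffProd R n z

theorem HasDistortion.one_le {D : ℝ} (hD : HasDistortion R D) (y : MarkovShift τ) : 1 ≤ D := by
  simpa [birkhoffProd] using hD 0 y y fun _ _ => rfl

theorem LocallyHolder.exists_abs_le [Finite W] {r : MarkovShift τ → ℝ} (hr : LocallyHolder r) :
    ∃ L : ℝ, ∀ y, |r y| ≤ L := by
  obtain ⟨C, θ, -, -, hvar⟩ := hr
  let π : MarkovShift τ → W × W := fun y => (y.1 0, y.1 1)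
  obtain ⟨M, hM⟩ := (Set.finite_range fun q : Set.range π =>
    |r (Set.rangeSplitting π q)|).bddAbove
  refine ⟨M + C * θ ^ 2, fun y => ?_⟩
  let z : MarkovShift τ := Set.rangeSplitting π ⟨π y, y, rfl⟩
  have hz : π z = π y := Set.apply_rangeSplitting π ⟨π y, y, rfl⟩
  have hrz : |r z| ≤ M := hM ⟨_, rfl⟩
  have hyz : |r y - r z| ≤ C * θ ^ 2 := by
    refine hvar 2 one_lt_two y z fun i hi => ?_
    interval_cases i
    exacts [(congrArg Prod.fst hz).symm, (congrArg Prod.snd hz).symm]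
  linarith [abs_sub_abs_le_abs_sub (r y) (r z)]

theorem LocallyHolder.exists_sub_le [Finite W] {r : MarkovShift τ → ℝ} (hr : LocallyHolder r) :
    ∃ K θ : ℝ, 0 ≤ K ∧ 0 < θ ∧ θ < 1 ∧
      ∀ n, 0 < n → ∀ y z, y ∈ cylinder z n → r y - r z ≤ K * θ ^ n := by
  obtain ⟨L, hL⟩ := hr.exists_abs_le
  obtain ⟨C, θ, hθ0, hθ1, hvar⟩ := hr
  refine ⟨max |C| (2 * |L| / θ), θ, by positivity, hθ0, hθ1, fun n hn y z hyz => ?_⟩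
  obtain rfl | hn1 : n = 1 ∨ 1 < n := by omega
  · calc r y - r z ≤ 2 * |L| := by
          linarith [abs_le.1 (hL y), abs_le.1 (hL z), le_abs_self L]
      _ = 2 * |L| / θ * θ ^ 1 := by field_simp
      _ ≤ max |C| (2 * |L| / θ) * θ ^ 1 := by gcongr; exact le_max_right _ _
  · calc r y - r z ≤ C * θ ^ n := (le_abs_self _).trans (hvar n hn1 y z hyz)
      _ ≤ max |C| (2 * |L| / θ) * θ ^ n := by
          gcongr; exact (le_abs_self C).trans (le_max_left _ _)

theorem birkhoffProd_le_exp_sum_mul (hR : ∀ y, 0 < R y) {v : ℕ → ℝ}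
    (hv : ∀ n, 0 < n → ∀ y z, y ∈ cylinder z n → Real.log (R y) - Real.log (R z) ≤ v n)
    (n : ℕ) {y z : MarkovShift τ} (hyz : y ∈ cylinder z n) :
    birkhoffProd R n y ≤ Real.exp (∑ i ∈ Finset.range n, v (i + 1)) * birkhoffProd R n z := by
  induction n generalizing y z with
  | zero => simp [birkhoffProd]
  | succ n ih =>
    have htail := ih (shift_iterate_mem_cylinder (k := 1) (by rwa [add_comm]))
    have hhead : R y ≤ Real.exp (v (n + 1)) * R z := by
      rw [← Real.log_le_log_iff (hR y) (by have := hR z; positivity),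
        Real.log_mul (Real.exp_ne_zero _) (hR z).ne', Real.log_exp]
      linarith [hv (n + 1) n.succ_pos y z hyz]
    rw [birkhoffProd_succ, birkhoffProd_succ, Finset.sum_range_succ, add_comm, Real.exp_add]
    calc R y * birkhoffProd R n (shift y)
        ≤ (Real.exp (v (n + 1)) * R z) *
          (Real.exp (∑ i ∈ Finset.range n, v (i + 1)) * birkhoffProd R n (shift z)) :=
          mul_le_mul hhead htail (birkhoffProd_pos hR _ _).le (by have := hR z; positivity)
      _ = _ := by ring

theorem LocallyHolder.exists_hasDistortion [Finite W] (hpos : ∀ y, 0 < R y)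
    (hR : LocallyHolder fun y => Real.log (R y)) : ∃ D, HasDistortion R D := by
  obtain ⟨K, θ, hK, hθ0, hθ1, hvar⟩ := hR.exists_sub_le
  refine ⟨Real.exp (K * (1 - θ)⁻¹), fun n y z hyz =>
    (birkhoffProd_le_exp_sum_mul hpos hvar n hyz).trans ?_⟩
  have hsum : ∑ i ∈ Finset.range n, K * θ ^ (i + 1) ≤ K * (1 - θ)⁻¹ := by
    rw [← Finset.mul_sum, ← tsum_geometric_of_lt_one hθ0.le hθ1]
    gcongr
    calc ∑ i ∈ Finset.range n, θ ^ (i + 1) ≤ ∑ i ∈ Finset.range n, θ ^ i :=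
          Finset.sum_le_sum fun i _ => pow_le_pow_of_le_one hθ0.le hθ1.le i.le_succ
      _ ≤ ∑' i, θ ^ i := (summable_geometric_of_lt_one hθ0.le hθ1).sum_le_tsum _
          fun i _ => by positivity
  have := (birkhoffProd_pos hpos n z).le
  gcongr

/-- The properties of the potential `R` that the argument uses: it is bounded away from `0` and
`∞`, and it has bounded distortion. -/
structure IsRegularPotential (R : MarkovShift τ → ℝ) : Prop where
  exists_lower : ∃ r > 0, ∀ y, r ≤ R y
  exists_upper : ∃ r, ∀ y, R y ≤ r
  exists_distortion : ∃ D, HasDistortion R D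

theorem IsRegularPotential.pos (hR : IsRegularPotential R) (y : MarkovShift τ) : 0 < R y := by
  obtain ⟨r, hr, hle⟩ := hR.exists_lower
  exact hr.trans_le (hle y)

theorem LocallyHolder.isRegularPotential [Finite W] (hpos : ∀ y, 0 < R y)
    (hR : LocallyHolder fun y => Real.log (R y)) : IsRegularPotential R := by
  obtain ⟨L, hL⟩ := hR.exists_abs_le
  refine ⟨⟨Real.exp (-L), Real.exp_pos _, fun y => ?_⟩, ⟨Real.exp L, fun y => ?_⟩,
    hR.exists_hasDistortion hpos⟩
  · exact (Real.le_log_iff_exp_le (hpos y)).1 (abs_le.1 (hL y)).1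
  · exact (Real.log_le_iff_le_exp (hpos y)).1 (abs_le.1 (hL y)).2

end BirkhoffProd

/-! ### Word sums and pressure -/

section Pressure

theorem tsum_le_mul_tsum_of_injective {α β : Type*} {f : α → ℝ≥0∞} {g : β → ℝ≥0∞} {C : ℝ≥0∞}
    {e : α → β} (he : Function.Injective e) (h : ∀ i, f i ≤ C * g (e i)) :
    ∑' i, f i ≤ C * ∑' j, g j :=
  calc ∑' i, f i ≤ ∑' i, C * g (e i) := ENNReal.tsum_le_tsum h
    _ ≤ C * ∑' j, g j := by
      rw [ENNReal.tsum_mul_left]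
      gcongr
      exact ENNReal.tsum_comp_le_tsum_of_injective he g

section AlmostSupermultiplicative

variable {u : ℕ → ℝ≥0∞} {C : ℝ≥0∞}

theorem pow_div_le_of_mul_le_mul (hC1 : 1 ≤ C) (hC : C ≠ ∞)
    (hu : ∀ n m, 0 < n → 0 < m → u n * u m ≤ C * u (n + m)) {n : ℕ} (hn : 0 < n) (k : ℕ) :
    (u n / C) ^ (k + 1) ≤ u (n * (k + 1)) / C := by
  have hC0 : C ≠ 0 := (zero_lt_one.trans_le hC1).ne'
  induction k with
  | zero => simp
  | succ k ih =>
    calc (u n / C) ^ (k + 1 + 1) = (u n / C) ^ (k + 1) * (u n / C) := pow_succ _ _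
      _ ≤ u (n * (k + 1)) / C * (u n / C) := by gcongr
      _ = u (n * (k + 1)) * u n / (C * C) := by
        simp only [div_eq_mul_inv, ENNReal.mul_inv (.inl hC0) (.inl hC)]; ring
      _ ≤ C * u (n * (k + 1) + n) / (C * C) :=
        ENNReal.div_le_div_right (hu _ _ (by positivity) hn) _
      _ = u (n * (k + 1 + 1)) / C := ENNReal.mul_div_mul_left _ _ hC0 hC

theorem le_of_mul_le_mul_of_limsup_log_div_le (hC1 : 1 ≤ C) (hC : C ≠ ∞)
    (hu : ∀ n m, 0 < n → 0 < m → u n * u m ≤ C * u (n + m))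
    (hlim : limsup (fun n : ℕ => ENNReal.log (u n) / (n : EReal)) atTop ≤ 0) {n : ℕ}
    (hn : 0 < n) : u n ≤ C := by
  have hC0 : C ≠ 0 := (zero_lt_one.trans_le hC1).ne'
  suffices hlog : ENNReal.log (u n / C) / n ≤ 0 by
    by_contra! hlt
    have hlog_pos : 0 < ENNReal.log (u n / C) := by
      rwa [ENNReal.zero_lt_log_iff, ENNReal.lt_div_iff_mul_lt (.inl hC0) (.inl hC), one_mul]
    exact hlog.not_gt (EReal.div_pos hlog_pos (by exact_mod_cast hn) (EReal.natCast_ne_top n))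
  refine le_trans (le_limsup_of_frequently_le ?_) hlim
  refine frequently_atTop.2 fun N => ⟨n * (N + 1), by nlinarith, ?_⟩
  calc ENNReal.log (u n / C) / n
      = ENNReal.log ((u n / C) ^ (N + 1)) / (n * (N + 1) : ℕ) := by
        rw [ENNReal.log_pow, EReal.natCast_mul, mul_comm ((N + 1 : ℕ) : EReal),
          EReal.mul_div_mul_cancel (EReal.natCast_ne_bot _) (EReal.natCast_ne_top _)
            (by exact_mod_cast N.succ_ne_zero)]
    _ ≤ ENNReal.log (u (n * (N + 1))) / (n * (N + 1) : ℕ) := by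
        refine EReal.div_le_div_right_of_nonneg (Nat.cast_nonneg' _) (ENNReal.log_monotone ?_)
        exact (pow_div_le_of_mul_le_mul hC1 hC hu hn N).trans
          (ENNReal.div_le_of_le_mul (le_mul_of_one_le_right' hC1))

end AlmostSupermultiplicative

variable {W : Type*} {τ : W → W → Prop} {R : MarkovShift τ → ℝ} {D : ℝ}

/-- The points of period `n` in the cylinder `[B]`. -/
abbrev PeriodicPoints (τ : W → W → Prop) (B : W) (n : ℕ) : Type _ :=
  {y : MarkovShift τ // y.1 0 = B ∧ shift^[n] y = y}

theorem PeriodicPoints.apply_period {B : W} {n : ℕ} (y : PeriodicPoints τ B n) : y.1.1 n = B := by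
  simpa only [y.2.2, y.2.1, Nat.zero_add, eq_comm] using shift_iterate_apply n y.1 0

/-- The sum of `R_n` over the points of period `n` in the cylinder `[B]`, whose exponential growth
rate is the Gurevič pressure. -/
def periodicSum (R : MarkovShift τ → ℝ) (B : W) (n : ℕ) : ℝ≥0∞ :=
  ∑' y : PeriodicPoints τ B n, ENNReal.ofReal (birkhoffProd R n y.1)

theorem tsum_birkhoffProd_le_mul_periodicSum {ι : Type*} (hD : HasDistortion R D) {B : W} {n : ℕ}
    (hn : 0 < n) (w : ι → MarkovShift τ) (hstart : ∀ i, (w i).1 0 = B) (hend : ∀ i, (w i).1 n = B)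
    (hinj : ∀ i j, w i ∈ cylinder (w j) n → i = j) :
    ∑' i, ENNReal.ofReal (birkhoffProd R n (w i)) ≤ ENNReal.ofReal D * periodicSum R B n := by
  have hclosed i : (w i).1 n = (w i).1 0 := (hend i).trans (hstart i).symm
  let loop : ι → PeriodicPoints τ B n := fun i =>
    ⟨periodize (w i) n hn (hclosed i), by rw [periodize_apply_of_le hn _ n.zero_le, hstart],
      shift_iterate_periodize hn _⟩
  have hloop i : w i ∈ cylinder (loop i).1 n := fun m hm =>
    (periodize_apply_of_le hn (hclosed i) hm.le).symm
  refine tsum_le_mul_tsum_of_injective (e := loop)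
    (fun i j hij => hinj i j fun m hm => ?_) fun i => ?_
  · rw [hloop i m hm, hloop j m hm, hij]
  · rw [← ENNReal.ofReal_mul (zero_le_one.trans (hD.one_le (w i)))]
    exact ENNReal.ofReal_le_ofReal (hD n _ _ (hloop i))

theorem periodicSum_mul_le (hR : ∀ y, 0 < R y) (hD : HasDistortion R D) (B : W) {n m : ℕ}
    (hn : 0 < n) (hm : 0 < m) :
    periodicSum R B n * periodicSum R B m ≤ ENNReal.ofReal D ^ 2 * periodicSum R B (n + m) := by
  let join : PeriodicPoints τ B n × PeriodicPoints τ B m → MarkovShift τ := fun p =>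
    glue p.1.1 n p.2.1 (p.1.apply_period.trans p.2.2.1.symm)
  have hhead p : p.1.1 ∈ cylinder (join p) n := fun i hi => (glue_apply_of_le _ hi.le).symm
  have htail p : shift^[n] (join p) = p.2.1 := shift_iterate_glue _
  have hprod p : ENNReal.ofReal (birkhoffProd R n p.1.1) * ENNReal.ofReal (birkhoffProd R m p.2.1) ≤
      ENNReal.ofReal D * ENNReal.ofReal (birkhoffProd R (n + m) (join p)) := by
    rw [birkhoffProd_add, htail, ENNReal.ofReal_mul (birkhoffProd_pos hR _ _).le, ← mul_assoc,
      ← ENNReal.ofReal_mul (zero_le_one.trans (hD.one_le p.1.1))]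
    gcongr
    exact hD n _ _ (hhead p)
  calc periodicSum R B n * periodicSum R B m
      = ∑' p : PeriodicPoints τ B n × PeriodicPoints τ B m,
          ENNReal.ofReal (birkhoffProd R n p.1.1) * ENNReal.ofReal (birkhoffProd R m p.2.1) := by
        rw [ENNReal.tsum_prod', periodicSum, periodicSum, ← ENNReal.tsum_mul_right]
        simp_rw [ENNReal.tsum_mul_left]
    _ ≤ ENNReal.ofReal D * ∑' p, ENNReal.ofReal (birkhoffProd R (n + m) (join p)) :=
        tsum_le_mul_tsum_of_injective Function.injective_id hprod
    _ ≤ ENNReal.ofReal D * (ENNReal.ofReal D * periodicSum R B (n + m)) := by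
        gcongr
        refine tsum_birkhoffProd_le_mul_periodicSum hD (by omega) join
          (fun p => ?_) (fun p => ?_) fun p q hpq => ?_
        · rw [glue_apply_of_le _ n.zero_le, p.1.2.1]
        · rw [add_comm, glue_apply_add, p.2.apply_period]
        · refine Prod.ext (Subtype.ext (eq_of_shift_iterate_eq_self hn p.1.2.2 q.1.2.2
            fun i hi => ?_)) (Subtype.ext (eq_of_shift_iterate_eq_self hm p.2.2.2 q.2.2.2
            fun i hi => ?_))
          · rw [hhead p i hi, hhead q i hi, hpq i (by omega)]
          · have := shift_iterate_mem_cylinder hpq i hi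
            rwa [htail, htail] at this
    _ = ENNReal.ofReal D ^ 2 * periodicSum R B (n + m) := by rw [← mul_assoc, ← sq]

theorem periodicSum_le_of_gurevicPressure_le (hR : ∀ y, 0 < R y) (hD : HasDistortion R D) {B : W}
    (hP : gurevicPressure R B ≤ 0) {n : ℕ} (hn : 0 < n) :
    periodicSum R B n ≤ ENNReal.ofReal D ^ 2 := by
  by_cases hne : Nonempty (PeriodicPoints τ B n)
  · obtain ⟨y⟩ := hne
    refine le_of_mul_le_mul_of_limsup_log_div_le (one_le_pow₀ ?_) (by finiteness)
      (fun _ _ => periodicSum_mul_le hR hD B) hP hn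
    simpa using hD.one_le y.1
  · simp [periodicSum, not_nonempty_iff.1 hne]

variable (τ) in
/-- The admissible words of length `n`. -/
abbrev Words (n : ℕ) : Type _ :=
  {u : Fin n → W // ∃ z : MarkovShift τ, ∀ i : Fin n, z.1 i = u i}

/-- A point of `Σ⁺` that starts with the word `u`. -/
def Words.rep {n : ℕ} (u : Words τ n) : MarkovShift τ := u.2.choose

theorem Words.rep_apply {n : ℕ} (u : Words τ n) {i : ℕ} (hi : i < n) :
    u.rep.1 i = u.1 ⟨i, hi⟩ := u.2.choose_spec ⟨i, hi⟩

/-- The word formed by the first `n` letters of `z`. -/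
def wordOf (z : MarkovShift τ) (n : ℕ) : Words τ n := ⟨fun i => z.1 i, z, fun _ => rfl⟩

theorem Words.ext_rep {n : ℕ} {u v : Words τ n} (h : u.rep ∈ cylinder v.rep n) : u = v := by
  ext i
  rw [← u.rep_apply i.2, ← v.rep_apply i.2, h i i.2]

theorem mem_cylinder_rep_wordOf (z : MarkovShift τ) (n : ℕ) : z ∈ cylinder (wordOf z n).rep n :=
  fun _ hi => ((wordOf z n).rep_apply hi).symm

theorem birkhoffProd_le_of_mem_cylinder_shift {r : ℝ} (hr : 0 < r) (hRr : ∀ y, r ≤ R y)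
    (hD : HasDistortion R D) {k n l : ℕ} {u y : MarkovShift τ}
    (h : u ∈ cylinder (shift^[k] y) n) :
    birkhoffProd R n u ≤ D * (r ^ (k + l))⁻¹ * birkhoffProd R (k + n + l) y := by
  have hD0 : 0 < D := zero_lt_one.trans_le (hD.one_le y)
  have hpos := birkhoffProd_pos fun z => hr.trans_le (hRr z)
  rw [birkhoffProd_add, birkhoffProd_add]
  calc birkhoffProd R n u ≤ D * birkhoffProd R n (shift^[k] y) := hD n _ _ h
    _ = D * (r ^ (k + l))⁻¹ * (r ^ k * birkhoffProd R n (shift^[k] y) * r ^ l) := by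
      rw [pow_add]; field_simp
    _ ≤ _ := by
      have := (hpos n (shift^[k] y)).le
      have := (hpos k y).le
      gcongr
      exacts [pow_le_birkhoffProd hr.le hRr k y, pow_le_birkhoffProd hr.le hRr l _]

theorem exists_tsum_words_birkhoffProd_le_of_ends (hR : IsRegularPotential R) {B E F : W}
    (hP : gurevicPressure R B ≤ 0) {p q : MarkovShift τ} {k l : ℕ} (hp0 : p.1 0 = B)
    (hpk : p.1 k = E) (hq0 : q.1 0 = F) (hql : q.1 l = B) :
    ∃ K ≠ ∞, ∀ n, 0 < n →
      ∑' u : {u : Words τ n // u.rep.1 0 = E ∧ u.rep.1 n = F},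
        ENNReal.ofReal (birkhoffProd R n u.1.rep) ≤ K := by
  obtain ⟨r, hr, hRr⟩ := hR.exists_lower
  obtain ⟨D, hD⟩ := hR.exists_distortion
  have hD0 : 0 < D := zero_lt_one.trans_le (hD.one_le p)
  refine ⟨ENNReal.ofReal (D * (r ^ (k + l))⁻¹) * (ENNReal.ofReal D * ENNReal.ofReal D ^ 2),
    by finiteness, fun n hn => ?_⟩
  let tail (u : {u : Words τ n // u.rep.1 0 = E ∧ u.rep.1 n = F}) : MarkovShift τ :=
    glue u.1.rep n q (u.2.2.trans hq0.symm)
  have htail0 u : (tail u).1 0 = E := (glue_apply_of_le _ n.zero_le).trans u.2.1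
  let loop u : MarkovShift τ := glue p k (tail u) (hpk.trans (htail0 u).symm)
  have hloop u : u.1.rep ∈ cylinder (shift^[k] (loop u)) n := fun i hi => by
    rw [shift_iterate_glue, glue_apply_of_le _ hi.le]
  calc ∑' u : {u : Words τ n // u.rep.1 0 = E ∧ u.rep.1 n = F},
        ENNReal.ofReal (birkhoffProd R n u.1.rep)
      ≤ ENNReal.ofReal (D * (r ^ (k + l))⁻¹) *
          ∑' u, ENNReal.ofReal (birkhoffProd R (k + n + l) (loop u)) := by
        refine tsum_le_mul_tsum_of_injective Function.injective_id fun u => ?_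
        rw [← ENNReal.ofReal_mul (by positivity)]
        exact ENNReal.ofReal_le_ofReal (birkhoffProd_le_of_mem_cylinder_shift hr hRr hD (hloop u))
    _ ≤ ENNReal.ofReal (D * (r ^ (k + l))⁻¹) *
          (ENNReal.ofReal D * periodicSum R B (k + n + l)) := by
        gcongr
        refine tsum_birkhoffProd_le_mul_periodicSum hD (by omega) loop (fun u => ?_) (fun u => ?_)
          fun u v huv => Subtype.ext (Words.ext_rep fun i hi => ?_)
        · rw [glue_apply_of_le _ k.zero_le, hp0]
        · rw [show k + n + l = l + n + k by omega, glue_apply_add, glue_apply_add, hql]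
        · rw [hloop u i hi, hloop v i hi]
          exact shift_iterate_mem_cylinder (cylinder_anti _ (by omega) huv) i hi
    _ ≤ _ := by
        gcongr
        exact periodicSum_le_of_gurevicPressure_le hR.pos hD hP (by omega)

theorem exists_tsum_words_birkhoffProd_le [Finite W] {G : Type*} [Group G] {s : W → G}
    (hs : WordsConnect τ s) (hR : IsRegularPotential R) {B : W} (hP : gurevicPressure R B ≤ 0) :
    ∃ K ≠ ∞, ∀ n, 0 < n → ∑' u : Words τ n, ENNReal.ofReal (birkhoffProd R n u.rep) ≤ K := by
  cases nonempty_fintype W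
  have hends (e : W × W) : ∃ K ≠ ∞, ∀ n, 0 < n →
      ∑' u : {u : Words τ n // u.rep.1 0 = e.1 ∧ u.rep.1 n = e.2},
        ENNReal.ofReal (birkhoffProd R n u.1.rep) ≤ K := by
    obtain ⟨p, k, hp0, hpk, -⟩ := hs B e.1 1
    obtain ⟨q, l, hq0, hql, -⟩ := hs e.2 B 1
    exact exists_tsum_words_birkhoffProd_le_of_ends hR hP hp0 hpk hq0 hql
  choose K hK hle using hends
  refine ⟨∑ e, K e, ENNReal.sum_ne_top.2 fun e _ => hK e, fun n hn => ?_⟩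
  rw [← ENNReal.tsum_fiberwise _ fun u : Words τ n => (u.rep.1 0, u.rep.1 n), tsum_fintype]
  refine Finset.sum_le_sum fun e _ => le_trans (le_of_eq ?_) (hle e n hn)
  refine tsum_congr_set_coe (fun u : Words τ n => ENNReal.ofReal (birkhoffProd R n u.rep)) ?_
  ext u
  exact Prod.ext_iff

end Pressure

/-! ### Non-negative vectors of `ℓ²` -/

section Cone

variable {α : Type*}

theorem ofReal_inner_eq_tsum {u v : lp (fun _ : α => ℝ) 2} (hu : ∀ q, 0 ≤ u q)
    (hv : ∀ q, 0 ≤ v q) :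
    ENNReal.ofReal (inner ℝ u v) = ∑' q, ENNReal.ofReal (u q) * ENNReal.ofReal (v q) := by
  have h := lp.hasSum_inner (𝕜 := ℝ) u v
  have hmul : ∀ q, inner ℝ (u q) (v q) = u q * v q := fun q => mul_comm (v q) (u q)
  simp_rw [hmul] at h
  rw [← h.tsum_eq, ENNReal.ofReal_tsum_of_nonneg (fun q => mul_nonneg (hu q) (hv q)) h.summable]
  exact tsum_congr fun q => ENNReal.ofReal_mul (hu q)

theorem inner_nonneg_of_nonneg {u v : lp (fun _ : α => ℝ) 2} (hu : ∀ q, 0 ≤ u q)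
    (hv : ∀ q, 0 ≤ v q) : 0 ≤ inner ℝ u v := by
  rw [lp.inner_eq_tsum]
  exact tsum_nonneg fun q => mul_nonneg (hv q) (hu q)

theorem ofReal_tsum_apply {ι : Type*} {u : ι → lp (fun _ : α => ℝ) 2} (hs : Summable u)
    (hu : ∀ i q, 0 ≤ u i q) (q : α) :
    ENNReal.ofReal ((∑' i, u i) q) = ∑' i, ENNReal.ofReal (u i q) := by
  have h : HasSum (fun i => u i q) ((∑' i, u i) q) :=
    hs.hasSum.mapL (lp.evalCLM ℝ (fun _ : α => ℝ) 2 q)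
  rw [← h.tsum_eq, ENNReal.ofReal_tsum_of_nonneg (fun i => hu i q) h.summable]

theorem norm_eq_sqrt_tsum_sq (u : lp (fun _ : α => ℝ) 2) : ‖u‖ = √(∑' q, u q ^ 2) := by
  rw [lp.norm_eq_tsum_rpow (by norm_num), Real.sqrt_eq_rpow]
  simp only [ENNReal.toReal_ofNat, Real.rpow_ofNat, Real.norm_eq_abs, sq_abs]

theorem summable_sq (u : lp (fun _ : α => ℝ) 2) : Summable fun q => u q ^ 2 := by
  simpa using (memℓp_gen_iff (by norm_num)).1 (lp.memℓp u)

theorem hasSum_of_forall_hasSum_apply {ι : Type*} {u : ι → lp (fun _ : α => ℝ) 2}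
    {U : lp (fun _ : α => ℝ) 2} (hu : ∀ i q, 0 ≤ u i q)
    (hU : ∀ q, HasSum (fun i => u i q) (U q)) : HasSum u U := by
  have hnorm : ∀ S : Finset ι, ‖∑ i ∈ S, u i - U‖ = √(∑' q, (∑ i ∈ S, u i q - U q) ^ 2) := by
    intro S
    simp only [norm_eq_sqrt_tsum_sq, lp.coeFn_sub, Pi.sub_apply, lp.coeFn_sum, Finset.sum_apply]
  rw [HasSum, SummationFilter.unconditional_filter, tendsto_iff_norm_sub_tendsto_zero]
  simp_rw [hnorm]
  rw [← Real.sqrt_zero]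
  refine (Real.continuous_sqrt.tendsto 0).comp ?_
  rw [show (0 : ℝ) = ∑' q : α, (U q - U q) ^ 2 by simp]
  refine tendsto_tsum_of_dominated_convergence (summable_sq U) (fun q => ?_)
    (Eventually.of_forall fun S q => ?_)
  · have h := hU q
    rw [HasSum, SummationFilter.unconditional_filter] at h
    exact (h.sub_const (U q)).pow 2
  · have h0 : 0 ≤ ∑ i ∈ S, u i q := Finset.sum_nonneg fun i _ => hu i q
    have h1 : ∑ i ∈ S, u i q ≤ U q := sum_le_hasSum S (fun i _ => hu i q) (hU q)
    rw [Real.norm_eq_abs, abs_of_nonneg (sq_nonneg _)]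
    nlinarith

theorem summable_of_tsum_sq_ne_top {ι : Type*} {u : ι → lp (fun _ : α => ℝ) 2}
    (hu : ∀ i q, 0 ≤ u i q) (h : ∑' q, (∑' i, ENNReal.ofReal (u i q)) ^ 2 ≠ ∞) :
    Summable u := by
  have hfin : ∀ q, ∑' i, ENNReal.ofReal (u i q) ≠ ∞ := fun q hq =>
    ENNReal.ne_top_of_tsum_ne_top h q (by simp [hq])
  let U : α → ℝ := fun q => (∑' i, ENNReal.ofReal (u i q)).toReal
  have hU : ∀ q, HasSum (fun i => u i q) (U q) := fun q => by
    have := ENNReal.hasSum_toReal (hfin q)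
    rw [← ENNReal.tsum_toReal_eq fun i => ENNReal.ofReal_ne_top] at this
    simpa only [ENNReal.toReal_ofReal (hu _ q)] using this
  have hmem : Memℓp (E := fun _ : α => ℝ) U 2 := by
    rw [memℓp_gen_iff (by norm_num)]
    simpa [U, ENNReal.toReal_pow] using ENNReal.summable_toReal h
  exact (hasSum_of_forall_hasSum_apply (U := ⟨U, hmem⟩) hu hU).summable

theorem tsum_mul_le_mul_tsum_sq {u v : α → ℝ≥0∞} {C : ℝ≥0∞} (h : ∀ q, u q ≤ C * v q) :
    ∑' q, u q * v q ≤ C * ∑' q, v q ^ 2 := by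
  rw [← ENNReal.tsum_mul_left]
  refine ENNReal.tsum_le_tsum fun q => ?_
  rw [sq, ← mul_assoc]
  gcongr
  exact h q

theorem tsum_iSup_of_monotone {u : ℕ → α → ℝ≥0∞} (hu : Monotone u) :
    ∑' q, ⨆ n, u n q = ⨆ n, ∑' q, u n q := by
  let _ : MeasurableSpace α := ⊤
  simp_rw [← lintegral_count]
  exact lintegral_iSup (fun n => measurable_from_top) hu

end Cone

/-! ### Inverse branches -/

section InverseBranch

variable {W : Type*} {τ : W → W → Prop} {G : Type*} [Group G]

/-- A non-empty word `v` with last letter `a` that can be prefixed to the point `x`, that is, an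
inverse branch of an iterate of the shift at `x`. It is encoded by its length and by the point
`vx`. -/
@[ext]
structure InverseBranch (a : W) (x : MarkovShift τ) where
  length : ℕ
  point : MarkovShift τ
  length_pos : 0 < length
  shift_iterate_point : shift^[length] point = x
  apply_length_sub_one : point.1 (length - 1) = a

namespace InverseBranch

variable {a : W} {x : MarkovShift τ}

/-- The group element `s(v)` of the branch `v`. -/
def value (s : W → G) (p : InverseBranch a x) : G :=
  wordValue s p.point 0 p.length

/-- The weight `b_n R_n(vx)` of the branch `v` of length `n`. -/
def weight (R : MarkovShift τ → ℝ) (b : ℕ → ℝ≥0∞) (p : InverseBranch a x) : ℝ≥0∞ :=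
  b p.length * ENNReal.ofReal (birkhoffProd R p.length p.point)

/-- The branches whose first letter is `A`. -/
def startingWith (A : W) : Set (InverseBranch a x) :=
  {p | p.point.1 0 = A}

/-- The branches of length at most `N` whose first letter is `A`. -/
def startingWithUpTo (A : W) (N : ℕ) : Set (InverseBranch a x) :=
  {p | p.point.1 0 = A ∧ p.length ≤ N}

theorem startingWithUpTo_subset (A : W) (N : ℕ) :
    startingWithUpTo A N ⊆ (startingWith A : Set (InverseBranch a x)) :=
  fun _ hp => hp.1

theorem monotone_startingWithUpTo (A : W) :
    Monotone (startingWithUpTo A : ℕ → Set (InverseBranch a x)) :=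
  fun _ _ h _ hp => ⟨hp.1, hp.2.trans h⟩

theorem iUnion_startingWithUpTo (A : W) :
    ⋃ N, startingWithUpTo A N = (startingWith A : Set (InverseBranch a x)) := by
  refine (Set.iUnion_subset (startingWithUpTo_subset A)).antisymm fun p hp => ?_
  exact Set.mem_iUnion.2 ⟨p.length, hp, le_rfl⟩

/-- The branch `uv`, where `u` consists of the first `k` letters of `z`. -/
def prepend (z : MarkovShift τ) (k : ℕ) (p : InverseBranch a x) (h : z.1 k = p.point.1 0) :
    InverseBranch a x where
  length := p.length + k
  point := glue z k p.point h
  length_pos := Nat.add_pos_left p.length_pos k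
  shift_iterate_point := by
    rw [Function.iterate_add_apply, shift_iterate_glue, p.shift_iterate_point]
  apply_length_sub_one := by
    rw [show p.length + k - 1 = (p.length - 1) + k by have := p.length_pos; omega, glue_apply_add,
      p.apply_length_sub_one]

/-- The branch obtained from `v` by deleting its first `n` letters. -/
def drop (n : ℕ) (p : InverseBranch a x) (h : n < p.length) : InverseBranch a x where
  length := p.length - n
  point := shift^[n] p.point
  length_pos := Nat.sub_pos_of_lt h
  shift_iterate_point := by
    rw [← Function.iterate_add_apply, Nat.sub_add_cancel h.le, p.shift_iterate_point]
  apply_length_sub_one := by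
    rw [shift_iterate_apply, show p.length - n - 1 + n = p.length - 1 by omega,
      p.apply_length_sub_one]

theorem prepend_point_mem_cylinder {z : MarkovShift τ} {k : ℕ} {p : InverseBranch a x}
    (h : z.1 k = p.point.1 0) : (p.prepend z k h).point ∈ cylinder z k :=
  fun _ hi => glue_apply_of_le h hi.le

theorem shift_iterate_prepend_point {z : MarkovShift τ} {k : ℕ} {p : InverseBranch a x}
    (h : z.1 k = p.point.1 0) : shift^[k] (p.prepend z k h).point = p.point :=
  shift_iterate_glue h

theorem value_eq_mul_of_mem_cylinder (s : W → G) {z : MarkovShift τ} {k : ℕ}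
    {p p' : InverseBranch a x} (hz : p'.point ∈ cylinder z k) (hp : shift^[k] p'.point = p.point)
    (hk : p'.length = p.length + k) : p'.value s = wordValue s z 0 k * p.value s := by
  rw [value, value, hk, Nat.add_comm, wordValue_add, hp,
    wordValue_congr s (show p'.point ∈ cylinder z (0 + k) by rwa [Nat.zero_add])]

theorem weight_le_of_shift_iterate_eq {R : MarkovShift τ → ℝ} {r : ℝ} (hr : 0 < r)
    (hRr : ∀ y, r ≤ R y) {k : ℕ} {p p' : InverseBranch a x} (hp : shift^[k] p'.point = p.point)
    (hk : p'.length = p.length + k) {b : ℕ → ℝ≥0∞} {K : ℝ≥0∞} (hb : ∀ n, b n ≤ K * b (n + k)) :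
    p.weight R b ≤ K * ENNReal.ofReal (r ^ k)⁻¹ * p'.weight R b := by
  have hprod : birkhoffProd R p.length p.point ≤
      (r ^ k)⁻¹ * birkhoffProd R p'.length p'.point := by
    rw [hk, Nat.add_comm, birkhoffProd_add, hp, ← div_eq_inv_mul, le_div_iff₀' (by positivity)]
    gcongr
    · exact (birkhoffProd_pos (fun y => hr.trans_le (hRr y)) _ _).le
    · exact pow_le_birkhoffProd hr.le hRr _ _
  calc p.weight R b
      ≤ (K * b (p.length + k)) *
        ENNReal.ofReal ((r ^ k)⁻¹ * birkhoffProd R p'.length p'.point) := by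
        rw [weight]
        gcongr
        exact hb _
    _ = K * ENNReal.ofReal (r ^ k)⁻¹ * p'.weight R b := by
        rw [weight, ENNReal.ofReal_mul (by positivity), hk]
        ring

theorem weight_le_of_mem_cylinder {R : MarkovShift τ → ℝ} (hRpos : ∀ y, 0 < R y) {D : ℝ}
    (hD : HasDistortion R D) {z : MarkovShift τ} {k : ℕ} {p p' : InverseBranch a x}
    (hz : p'.point ∈ cylinder z k) (hp : shift^[k] p'.point = p.point)
    (hk : p'.length = p.length + k) {b : ℕ → ℝ≥0∞} {K : ℝ≥0∞}
    (hb : b p'.length ≤ K * b p.length) :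
    p'.weight R b ≤ K * ENNReal.ofReal (D * birkhoffProd R k z) * p.weight R b := by
  have hpos := (birkhoffProd_pos hRpos p.length p.point).le
  have hprod : birkhoffProd R p'.length p'.point ≤
      (D * birkhoffProd R k z) * birkhoffProd R p.length p.point := by
    rw [hk, Nat.add_comm, birkhoffProd_add, hp]
    exact mul_le_mul_of_nonneg_right (hD k _ z hz) hpos
  calc p'.weight R b
      ≤ (K * b p.length) *
        ENNReal.ofReal ((D * birkhoffProd R k z) * birkhoffProd R p.length p.point) := by
        rw [weight]
        gcongr
    _ = K * ENNReal.ofReal (D * birkhoffProd R k z) * p.weight R b := by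
        rw [weight, ENNReal.ofReal_mul' hpos]
        ring

theorem injective_prefix_of_length_eq (n : ℕ) :
    Function.Injective fun (p : {p : InverseBranch a x // p.length = n}) (i : Fin n) =>
      p.1.point.1 i := by
  rintro ⟨p, hp⟩ ⟨p', hp'⟩ h
  refine Subtype.ext (InverseBranch.ext (hp.trans hp'.symm) (ext_of_prefix_of_shift n
    (fun i hi => congrFun h ⟨i, hi⟩) ?_))
  have hpx := p.shift_iterate_point
  have hpx' := p'.shift_iterate_point
  rw [hp] at hpx
  rw [hp'] at hpx'
  exact hpx.trans hpx'.symm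

theorem finite_setOf_length_eq [Finite W] (n : ℕ) :
    {p : InverseBranch a x | p.length = n}.Finite :=
  Finite.of_injective _ (injective_prefix_of_length_eq n)

theorem finite_setOf_length_le [Finite W] (N : ℕ) :
    {p : InverseBranch a x | p.length ≤ N}.Finite := by
  refine ((Set.finite_Iic N).biUnion fun n _ => finite_setOf_length_eq n).subset fun p hp => ?_
  exact Set.mem_biUnion (Set.mem_Iic.2 hp) rfl

theorem tsum_weight_ne_top_of_finite {R : MarkovShift τ → ℝ} {b : ℕ → ℝ≥0∞} (hb : ∀ n, b n ≠ ∞)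
    {P : Set (InverseBranch a x)} (hP : P.Finite) : ∑' p : P, p.1.weight R b ≠ ∞ := by
  have := hP.fintype
  rw [tsum_fintype]
  exact ENNReal.sum_ne_top.2 fun p _ => ENNReal.mul_ne_top (hb _) ENNReal.ofReal_ne_top

/-- Branches are the points summed over in `approxMeasure`, listed by length. -/
def equivSigma (a : W) (x : MarkovShift τ) :
    InverseBranch a x ≃ Σ n : ℕ, {y : MarkovShift τ // shift^[n + 1] y = x ∧ y.1 n = a} where
  toFun p := ⟨p.length - 1, p.point, by
    rw [Nat.sub_add_cancel p.length_pos, p.shift_iterate_point], p.apply_length_sub_one⟩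
  invFun y := ⟨y.1 + 1, y.2.1, y.1.succ_pos, y.2.2.1, y.2.2.2⟩
  left_inv p := InverseBranch.ext (Nat.sub_add_cancel p.length_pos) rfl
  right_inv _ := rfl

end InverseBranch

end InverseBranch

/-! ### Weighted series over inverse branches -/

section Series

open InverseBranch

variable {W : Type*} {τ : W → W → Prop} {G : Type*} [Group G] {I : Type*} {H : I → Subgroup G}
  {a : W} {x : MarkovShift τ}

/-- The coordinate `q` of `∑ b_n R_n(vx) ρ(s(v)) f`, the sum being over the branches `v ∈ P`, with
values in `[0, ∞]` so that no convergence is required. -/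
def series (R : MarkovShift τ → ℝ) (s : W → G) (f : QuotientSum H) (b : ℕ → ℝ≥0∞)
    (P : Set (InverseBranch a x)) (q : Σ i, G ⧸ H i) : ℝ≥0∞ :=
  ∑' p : P, p.1.weight R b * ENNReal.ofReal (f ((p.1.value s)⁻¹ • q))

/-- The square of the norm of a weighted series. -/
def normSq (R : MarkovShift τ → ℝ) (s : W → G) (f : QuotientSum H) (b : ℕ → ℝ≥0∞)
    (P : Set (InverseBranch a x)) : ℝ≥0∞ :=
  ∑' q, series R s f b P q ^ 2

variable {R : MarkovShift τ → ℝ} {s : W → G} {f : QuotientSum H} {P P' : Set (InverseBranch a x)}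

theorem series_mono (b : ℕ → ℝ≥0∞) (hP : P ⊆ P') (q : Σ i, G ⧸ H i) :
    series R s f b P q ≤ series R s f b P' q :=
  ENNReal.tsum_mono_subtype
    (fun p : InverseBranch a x => p.weight R b * ENNReal.ofReal (f ((p.value s)⁻¹ • q))) hP

theorem series_le_mul {b b' : ℕ → ℝ≥0∞} {C : ℝ≥0∞} (h : ∀ p ∈ P, b p.length ≤ C * b' p.length)
    (q : Σ i, G ⧸ H i) : series R s f b P q ≤ C * series R s f b' P q := by
  refine tsum_le_mul_tsum_of_injective Function.injective_id fun p => ?_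
  have hp := h p p.2
  calc p.1.weight R b * ENNReal.ofReal (f ((p.1.value s)⁻¹ • q))
      ≤ C * b' p.1.length * ENNReal.ofReal (birkhoffProd R p.1.length p.1.point) *
        ENNReal.ofReal (f ((p.1.value s)⁻¹ • q)) := by
        rw [weight]
        gcongr
    _ = _ := by rw [weight]; simp only [id, mul_assoc]

theorem normSq_mono (b : ℕ → ℝ≥0∞) (hP : P ⊆ P') : normSq R s f b P ≤ normSq R s f b P' :=
  ENNReal.tsum_le_tsum fun q => pow_le_pow_left' (series_mono b hP q) 2

theorem normSq_le_mul {b b' : ℕ → ℝ≥0∞} {C : ℝ≥0∞} (h : ∀ p ∈ P, b p.length ≤ C * b' p.length) :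
    normSq R s f b P ≤ C ^ 2 * normSq R s f b' P := by
  rw [normSq, normSq, ← ENNReal.tsum_mul_left]
  refine ENNReal.tsum_le_tsum fun q => ?_
  rw [← mul_pow]
  exact pow_le_pow_left' (series_le_mul h q) 2

theorem series_iUnion (b : ℕ → ℝ≥0∞) {P : ℕ → Set (InverseBranch a x)} (hP : Monotone P)
    (q : Σ i, G ⧸ H i) : series R s f b (⋃ N, P N) q = ⨆ N, series R s f b (P N) q := by
  let u : InverseBranch a x → ℝ≥0∞ := fun p =>
    p.weight R b * ENNReal.ofReal (f ((p.value s)⁻¹ • q))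
  have hu : ∀ Q, series R s f b Q q = ∑' p, Q.indicator u p := fun Q => tsum_subtype Q u
  simp only [hu]
  rw [← tsum_iSup_of_monotone fun N M h => Set.indicator_le_indicator_of_subset (hP h) fun _ =>
    zero_le]
  exact tsum_congr fun p => Set.indicator_iUnion_apply rfl P u p

theorem normSq_iUnion (b : ℕ → ℝ≥0∞) {P : ℕ → Set (InverseBranch a x)} (hP : Monotone P) :
    normSq R s f b (⋃ N, P N) = ⨆ N, normSq R s f b (P N) := by
  have hmono : ∀ q, Monotone fun N => series R s f b (P N) q :=
    fun q N M h => series_mono b (hP h) q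
  simp only [normSq]
  rw [← tsum_iSup_of_monotone fun N M h q => pow_le_pow_left' (hmono q h) 2]
  exact tsum_congr fun q => by rw [series_iUnion b hP, ENNReal.iSup_pow_of_ne_zero two_ne_zero]

theorem normSq_startingWith_eq_iSup (b : ℕ → ℝ≥0∞) (A : W) :
    normSq R s f b (startingWith A : Set (InverseBranch a x)) =
      ⨆ N, normSq R s f b (startingWithUpTo A N : Set (InverseBranch a x)) := by
  rw [← iUnion_startingWithUpTo, normSq_iUnion b (monotone_startingWithUpTo A)]

theorem series_startingWith_le {r : ℝ} (hr : 0 < r) (hRr : ∀ y, r ≤ R y) (z : MarkovShift τ)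
    (k : ℕ) {b : ℕ → ℝ≥0∞} {K : ℝ≥0∞} (hb : ∀ n, b n ≤ K * b (n + k)) (q : Σ i, G ⧸ H i) :
    series R s f b (startingWith (z.1 k) : Set (InverseBranch a x)) ((wordValue s z 0 k)⁻¹ • q) ≤
      K * ENNReal.ofReal (r ^ k)⁻¹ *
        series R s f b (startingWith (z.1 0) : Set (InverseBranch a x)) q := by
  let e : (startingWith (z.1 k) : Set (InverseBranch a x)) →
      (startingWith (z.1 0) : Set (InverseBranch a x)) :=
    fun p => ⟨p.1.prepend z k p.2.symm, glue_apply_of_le p.2.symm k.zero_le⟩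
  have hshift : ∀ p, shift^[k] (e p).1.point = p.1.point :=
    fun p => shift_iterate_prepend_point p.2.symm
  have he : Function.Injective e := fun p p' h => by
    refine Subtype.ext (InverseBranch.ext ?_ ?_)
    · exact Nat.add_right_cancel (congrArg (fun w => w.1.length) h)
    · rw [← hshift p, ← hshift p', h]
  refine tsum_le_mul_tsum_of_injective he fun p => ?_
  rw [← mul_assoc, value_eq_mul_of_mem_cylinder s (prepend_point_mem_cylinder p.2.symm)
    (hshift p) rfl, mul_inv_rev, mul_smul]
  gcongr
  exact weight_le_of_shift_iterate_eq hr hRr (hshift p) rfl hb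

theorem series_cylinder_le (hRpos : ∀ y, 0 < R y) {D : ℝ} (hD : HasDistortion R D)
    (z : MarkovShift τ) (n N : ℕ) {b : ℕ → ℝ≥0∞} {K : ℝ≥0∞}
    (hb : ∀ m ≥ N, b (m + n) ≤ K * b m) (q : Σ i, G ⧸ H i) :
    series R s f b {p : InverseBranch a x | N + n < p.length ∧ p.point ∈ cylinder z n} q ≤
      K * ENNReal.ofReal (D * birkhoffProd R n z) *
        series R s f b (Set.univ : Set (InverseBranch a x)) ((wordValue s z 0 n)⁻¹ • q) := by
  let Q := {p : InverseBranch a x | N + n < p.length ∧ p.point ∈ cylinder z n}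
  have hlt : ∀ p : Q, N + n < p.1.length := fun p => p.2.1
  let e : Q → (Set.univ : Set (InverseBranch a x)) := fun p => ⟨p.1.drop n (by grind), trivial⟩
  have hlen : ∀ p, p.1.length = (e p).1.length + n := fun p => by
    have := hlt p
    exact (Nat.sub_add_cancel (by omega)).symm
  have he : Function.Injective e := fun p p' h => by
    refine Subtype.ext (InverseBranch.ext (by rw [hlen p, hlen p', h]) ?_)
    refine ext_of_prefix_of_shift n (fun i hi => ?_) (congrArg (fun w => w.1.point) h)
    rw [p.2.2 i hi, p'.2.2 i hi]
  refine tsum_le_mul_tsum_of_injective he fun p => ?_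
  rw [← mul_assoc, value_eq_mul_of_mem_cylinder s p.2.2 rfl (hlen p), mul_inv_rev, mul_smul]
  gcongr
  refine weight_le_of_mem_cylinder hRpos hD p.2.2 rfl (hlen p) ?_
  have := hlt p
  rw [hlen p]
  exact hb _ (by have := hlen p; omega)

end Series

/-! ### The vectors `φ_c[t] ∗_ρ f` -/

section PhiVec

open InverseBranch

variable {W : Type*} {τ : W → W → Prop} {G : Type*} [Group G] {I : Type*} {H : I → Subgroup G}
  {a : W} {x : MarkovShift τ}

theorem tsum_tsum_inter_preimage {α β : Type*} (g : α → β) (P : Set α) (u : α → ℝ≥0∞) :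
    ∑' y, ∑' p : (P ∩ g ⁻¹' {y} : Set α), u p = ∑' p : P, u p := by
  rw [tsum_subtype, ← ENNReal.tsum_fiberwise _ g]
  refine tsum_congr fun y => ?_
  rw [tsum_subtype, tsum_subtype, Set.inter_comm, Set.indicator_indicator]

/-- The value at `h` of the `G`-density with coefficients `b`, restricted to the branches
in `P`. -/
def groupWeight (R : MarkovShift τ → ℝ) (s : W → G) (b : ℕ → ℝ≥0∞) (P : Set (InverseBranch a x))
    (h : G) : ℝ≥0∞ :=
  ∑' p : (P ∩ value s ⁻¹' {h} : Set (InverseBranch a x)), p.1.weight R b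

/-- The coefficients `t⁻ⁿ c_n`. -/
def coeff (c : ℕ → ℝ) (t : ℝ) (n : ℕ) : ℝ≥0∞ := ENNReal.ofReal ((t ^ n)⁻¹ * c n)

theorem coeff_ne_top (c : ℕ → ℝ) (t : ℝ) (n : ℕ) : coeff c t n ≠ ∞ := ENNReal.ofReal_ne_top

variable {R : MarkovShift τ → ℝ} {s : W → G} {A : W} {f : QuotientSum H}

theorem tsum_groupWeight (b : ℕ → ℝ≥0∞) (P : Set (InverseBranch a x)) :
    ∑' h, groupWeight R s b P h = ∑' p : P, p.1.weight R b :=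
  tsum_tsum_inter_preimage (value s) P (weight R b)

theorem series_eq_tsum_groupWeight (b : ℕ → ℝ≥0∞) (P : Set (InverseBranch a x))
    (q : Σ i, G ⧸ H i) :
    series R s f b P q = ∑' h, groupWeight R s b P h * ENNReal.ofReal (f (h⁻¹ • q)) := by
  rw [series, ← tsum_tsum_inter_preimage (value s) P fun p =>
    p.weight R b * ENNReal.ofReal (f ((p.value s)⁻¹ • q))]
  refine tsum_congr fun h => ?_
  rw [groupWeight, ← ENNReal.tsum_mul_right]
  exact tsum_congr fun p => by rw [show p.1.value s = h from p.2.2]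

theorem groupWeight_eq_tsum_length (b : ℕ → ℝ≥0∞) (P : Set (InverseBranch a x)) (g : G) :
    groupWeight R s b P g = ∑' n, groupWeight R s b (P ∩ length ⁻¹' {n}) g := by
  rw [groupWeight, ← tsum_tsum_inter_preimage length]
  refine tsum_congr fun n => ?_
  rw [Set.inter_right_comm, groupWeight]

theorem groupWeight_eq_zero_of_eq_empty {b : ℕ → ℝ≥0∞} {P : Set (InverseBranch a x)}
    (hP : P = ∅) (g : G) : groupWeight R s b P g = 0 := by
  subst hP
  rw [groupWeight, Set.empty_inter, tsum_empty]

/-- The branches of length `n` and value `g` starting with `A` are the points summed over in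
`phiTerm`. -/
def pointEquiv (s : W → G) (A a : W) (x : MarkovShift τ) {n : ℕ} (hn : 0 < n) (g : G) :
    {y : MarkovShift τ // shift^[n] y = x ∧ y.1 0 = A ∧ y.1 (n - 1) = a ∧ wordValue s y 0 n = g} ≃
      (startingWith A ∩ length ⁻¹' {n} ∩ value s ⁻¹' {g} : Set (InverseBranch a x)) where
  toFun y := ⟨⟨n, y.1, hn, y.2.1, y.2.2.2.1⟩, ⟨y.2.2.1, rfl⟩, y.2.2.2.2⟩
  invFun p := ⟨p.1.point, by
    obtain ⟨p, ⟨hA, rfl⟩, hg⟩ := p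
    exact ⟨p.shift_iterate_point, hA, p.apply_length_sub_one, hg⟩⟩
  left_inv _ := rfl
  right_inv p := Subtype.ext (InverseBranch.ext p.2.1.2.symm rfl)

theorem phiTerm_nonneg (hRpos : ∀ y, 0 < R y) {c : ℕ → ℝ} (hc : ∀ n, 0 ≤ c n) {t : ℝ}
    (ht : 0 < t) (n : ℕ) (g : G) : 0 ≤ phiTerm R s A a x c t n g :=
  mul_nonneg (mul_nonneg (by positivity) (hc n))
    (tsum_nonneg fun y => (birkhoffProd_pos hRpos _ _).le)

theorem phi_nonneg (hRpos : ∀ y, 0 < R y) {c : ℕ → ℝ} (hc : ∀ n, 0 ≤ c n) {t : ℝ}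
    (ht : 0 < t) (g : G) : 0 ≤ phi R s A a x c t g :=
  tsum_nonneg fun _ => phiTerm_nonneg hRpos hc ht _ g

theorem phiPartial_nonneg (hRpos : ∀ y, 0 < R y) {c : ℕ → ℝ} (hc : ∀ n, 0 ≤ c n) {t : ℝ}
    (ht : 0 < t) (N : ℕ) (g : G) : 0 ≤ phiPartial R s A a x c N t g :=
  Finset.sum_nonneg fun _ _ => phiTerm_nonneg hRpos hc ht _ g

theorem ofReal_phiTerm [Finite W] (hRpos : ∀ y, 0 < R y) {c : ℕ → ℝ} (hc : ∀ n, 0 ≤ c n) {t : ℝ}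
    (ht : 0 < t) {n : ℕ} (hn : 0 < n) (g : G) :
    ENNReal.ofReal (phiTerm R s A a x c t n g) =
      groupWeight R s (coeff c t)
        (startingWith A ∩ length ⁻¹' {n} : Set (InverseBranch a x)) g := by
  let e := pointEquiv s A a x hn g
  have hfin : (startingWith A ∩ length ⁻¹' {n} ∩ value s ⁻¹' {g} :
      Set (InverseBranch a x)).Finite :=
    (finite_setOf_length_eq n).subset fun _ hp => hp.1.2
  have := hfin.to_subtype
  have := Finite.of_equiv _ e.symm
  rw [phiTerm, ENNReal.ofReal_mul (mul_nonneg (by positivity) (hc n)),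
    ENNReal.ofReal_tsum_of_nonneg (fun y => (birkhoffProd_pos hRpos _ _).le)
      (Summable.of_finite ..), ← ENNReal.tsum_mul_left]
  exact e.tsum_eq fun p => p.1.weight R (coeff c t)

theorem ofReal_phiPartial [Finite W] (hRpos : ∀ y, 0 < R y) {c : ℕ → ℝ} (hc : ∀ n, 0 ≤ c n)
    {t : ℝ} (ht : 0 < t) (N : ℕ) (g : G) :
    ENNReal.ofReal (phiPartial R s A a x c N t g) =
      groupWeight R s (coeff c t) (startingWithUpTo A N : Set (InverseBranch a x)) g := by
  rw [phiPartial, ENNReal.ofReal_sum_of_nonneg fun n _ => phiTerm_nonneg hRpos hc ht n g,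
    groupWeight_eq_tsum_length, tsum_eq_sum (s := Finset.Icc 1 N)]
  · refine Finset.sum_congr rfl fun n hn => ?_
    rw [Finset.mem_Icc] at hn
    rw [ofReal_phiTerm hRpos hc ht hn.1]
    congr 1
    ext p
    refine and_congr_left fun hp => ⟨fun h => ⟨h, ?_⟩, And.left⟩
    exact (show p.length = n from hp).trans_le hn.2
  · intro n hn
    refine groupWeight_eq_zero_of_eq_empty (Set.eq_empty_of_forall_notMem ?_) g
    rintro p ⟨hp, rfl⟩
    exact hn (Finset.mem_Icc.2 ⟨p.length_pos, hp.2⟩)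

theorem ofReal_phi [Finite W] (hRpos : ∀ y, 0 < R y) {c : ℕ → ℝ} (hc : ∀ n, 0 ≤ c n)
    {t : ℝ} (ht : 0 < t) {g : G}
    (hg : groupWeight R s (coeff c t) (startingWith A : Set (InverseBranch a x)) g ≠ ∞) :
    ENNReal.ofReal (phi R s A a x c t g) =
      groupWeight R s (coeff c t) (startingWith A : Set (InverseBranch a x)) g := by
  have hsum : groupWeight R s (coeff c t) (startingWith A : Set (InverseBranch a x)) g =
      ∑' n, ENNReal.ofReal (phiTerm R s A a x c t (n + 1) g) := by
    rw [groupWeight_eq_tsum_length, tsum_eq_zero_add' ENNReal.summable,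
      groupWeight_eq_zero_of_eq_empty (Set.eq_empty_of_forall_notMem ?_), zero_add]
    · exact tsum_congr fun n => (ofReal_phiTerm hRpos hc ht n.succ_pos g).symm
    · rintro p ⟨-, hp⟩
      exact p.length_pos.ne' hp
  have hnonneg := fun n => phiTerm_nonneg (s := s) (A := A) (a := a) (x := x) hRpos hc ht (n + 1) g
  rw [hsum] at hg ⊢
  refine ENNReal.ofReal_tsum_of_nonneg hnonneg ?_
  simpa only [ENNReal.toReal_ofReal (hnonneg _)] using ENNReal.summable_toReal hg

theorem rho_apply (g : G) (v : QuotientSum H) (q : Σ i, G ⧸ H i) : rho H g v q = v (g⁻¹ • q) := rfl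

theorem inCone_smul_rho (hf : InCone f) {φ : G → ℝ} (hφ : ∀ h, 0 ≤ φ h) (h : G) :
    InCone (φ h • rho H h f) := by
  intro q
  rw [lp.coeFn_smul, Pi.smul_apply, rho_apply]
  exact mul_nonneg (hφ h) (hf _)

theorem ofReal_smul_rho {φ : G → ℝ} (hφ : ∀ h, 0 ≤ φ h) (h : G)
    (q : Σ i, G ⧸ H i) : ENNReal.ofReal ((φ h • rho H h f) q) =
      ENNReal.ofReal (φ h) * ENNReal.ofReal (f (h⁻¹ • q)) := by
  rw [lp.coeFn_smul, Pi.smul_apply, rho_apply, smul_eq_mul, ENNReal.ofReal_mul (hφ h)]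

theorem inCone_conv (hf : InCone f) {φ : G → ℝ} (hφ : ∀ h, 0 ≤ φ h) : InCone (conv φ f) := by
  intro q
  by_cases hs : Summable fun h => φ h • rho H h f
  · have hq : HasSum (fun h => (φ h • rho H h f) q) (conv φ f q) :=
      hs.hasSum.mapL (lp.evalCLM ℝ (fun _ : (Σ i, G ⧸ H i) => ℝ) 2 q)
    exact hq.nonneg fun h => inCone_smul_rho hf hφ h q
  · rw [conv, tsum_eq_zero_of_not_summable hs]
    exact le_rfl

theorem summable_smul_rho {φ : G → ℝ} (hφ : ∀ h, 0 ≤ φ h)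
    (h : ∑' h, ENNReal.ofReal (φ h) ≠ ∞) : Summable fun h => φ h • rho H h f := by
  refine Summable.of_norm ?_
  have hsum := ENNReal.summable_toReal h
  simp only [ENNReal.toReal_ofReal (hφ _)] at hsum
  refine (hsum.mul_right ‖f‖).congr fun h => ?_
  rw [norm_smul, LinearIsometryEquiv.norm_map, Real.norm_of_nonneg (hφ h)]

theorem ofReal_conv_apply (hf : InCone f) {φ : G → ℝ} (hφ : ∀ h, 0 ≤ φ h)
    (hs : Summable fun h => φ h • rho H h f) {b : ℕ → ℝ≥0∞} {P : Set (InverseBranch a x)}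
    (hb : ∀ h, ENNReal.ofReal (φ h) = groupWeight R s b P h) (q : Σ i, G ⧸ H i) :
    ENNReal.ofReal (conv φ f q) = series R s f b P q := by
  rw [conv, ofReal_tsum_apply hs fun h => inCone_smul_rho hf hφ h, series_eq_tsum_groupWeight]
  simp_rw [ofReal_smul_rho hφ, hb]

theorem ofReal_inner_conv (hf : InCone f) {φ : G → ℝ} (hφ : ∀ h, 0 ≤ φ h)
    (hs : Summable fun h => φ h • rho H h f) {b : ℕ → ℝ≥0∞} {P : Set (InverseBranch a x)}
    (hb : ∀ h, ENNReal.ofReal (φ h) = groupWeight R s b P h) :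
    ENNReal.ofReal (inner ℝ (conv φ f) (conv φ f)) = normSq R s f b P := by
  rw [ofReal_inner_eq_tsum (inCone_conv hf hφ) (inCone_conv hf hφ), normSq]
  simp_rw [ofReal_conv_apply hf hφ hs hb, sq]

theorem normSq_ne_top (hf : InCone f) {b : ℕ → ℝ≥0∞} {P : Set (InverseBranch a x)}
    (hP : ∑' p : P, p.1.weight R b ≠ ∞) : normSq R s f b P ≠ ∞ := by
  have hsum : ∑' h, groupWeight R s b P h ≠ ∞ := by rwa [tsum_groupWeight]
  have hreal : ∀ h, ENNReal.ofReal (groupWeight R s b P h).toReal = groupWeight R s b P h :=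
    fun h => ENNReal.ofReal_toReal (ENNReal.ne_top_of_tsum_ne_top hsum h)
  have hnonneg : ∀ h, 0 ≤ (groupWeight R s b P h).toReal := fun h => ENNReal.toReal_nonneg
  rw [← ofReal_inner_conv hf hnonneg (summable_smul_rho hnonneg (by simpa only [hreal])) hreal]
  exact ENNReal.ofReal_ne_top

theorem tsum_weight_startingWithUpTo_ne_top [Finite W] {b : ℕ → ℝ≥0∞} (hb : ∀ n, b n ≠ ∞) (N : ℕ) :
    ∑' p : (startingWithUpTo A N : Set (InverseBranch a x)), p.1.weight R b ≠ ∞ :=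
  tsum_weight_ne_top_of_finite hb ((finite_setOf_length_le N).subset fun _ hp => hp.2)

theorem ofReal_inner_phiPartial [Finite W] (hRpos : ∀ y, 0 < R y) (hf : InCone f) {c : ℕ → ℝ}
    (hc : ∀ n, 0 ≤ c n) {t : ℝ} (ht : 0 < t) (N : ℕ) :
    ENNReal.ofReal (inner ℝ (conv (phiPartial R s A a x c N t) f)
      (conv (phiPartial R s A a x c N t) f)) =
      normSq R s f (coeff c t) (startingWithUpTo A N : Set (InverseBranch a x)) := by
  have hphi := fun g => ofReal_phiPartial (s := s) (A := A) (a := a) (x := x) hRpos hc ht N g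
  have hnonneg := fun g => phiPartial_nonneg (s := s) (A := A) (a := a) (x := x) hRpos hc ht N g
  refine ofReal_inner_conv hf hnonneg (summable_smul_rho hnonneg ?_) hphi
  simp_rw [hphi, tsum_groupWeight]
  exact tsum_weight_startingWithUpTo_ne_top (coeff_ne_top c t) N

theorem bddAbove_iff_normSq_ne_top [Finite W] (hRpos : ∀ y, 0 < R y) (hf : InCone f) {c : ℕ → ℝ}
    (hc : ∀ n, 0 ≤ c n) {t : ℝ} (ht : 0 < t) :
    BddAbove (Set.range fun N : ℕ => inner ℝ (conv (phiPartial R s A a x c N t) f)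
      (conv (phiPartial R s A a x c N t) f)) ↔
      normSq R s f (coeff c t) (startingWith A : Set (InverseBranch a x)) ≠ ∞ := by
  rw [normSq_startingWith_eq_iSup]
  simp_rw [← ofReal_inner_phiPartial (s := s) (A := A) (a := a) (x := x) hRpos hf hc ht]
  constructor
  · rintro ⟨K, hK⟩
    exact ne_top_of_le_ne_top ENNReal.ofReal_ne_top
      (iSup_le fun N => ENNReal.ofReal_le_ofReal (hK ⟨N, rfl⟩))
  · rintro h
    refine ⟨_, Set.forall_mem_range.2 fun N => (ENNReal.ofReal_le_iff_le_toReal h).1 ?_⟩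
    exact le_iSup (fun N => ENNReal.ofReal (inner ℝ (conv (phiPartial R s A a x c N t) f)
      (conv (phiPartial R s A a x c N t) f))) N

theorem exists_pos_of_ne_zero (hf : InCone f) (hf0 : f ≠ 0) : ∃ q, 0 < f q := by
  by_contra! h
  exact hf0 (by ext q; exact le_antisymm (h q) (hf q))

theorem groupWeight_ne_top (hf : InCone f) (hf0 : f ≠ 0) {b : ℕ → ℝ≥0∞}
    {P : Set (InverseBranch a x)} (h : normSq R s f b P ≠ ∞) (g : G) :
    groupWeight R s b P g ≠ ∞ := by
  obtain ⟨q, hq⟩ := exists_pos_of_ne_zero hf hf0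
  have hseries : series R s f b P (g • q) ≠ ∞ := fun hq => by
    refine ENNReal.ne_top_of_tsum_ne_top h (g • q) ?_
    rw [hq, ENNReal.top_pow two_ne_zero]
  rw [series_eq_tsum_groupWeight] at hseries
  intro hg
  refine ENNReal.ne_top_of_tsum_ne_top hseries g ?_
  rw [hg, inv_smul_smul]
  exact ENNReal.top_mul (ENNReal.ofReal_pos.2 hq).ne'

theorem inCone_phiVec (hRpos : ∀ y, 0 < R y) (hf : InCone f) {c : ℕ → ℝ}
    (hc : ∀ n, 0 ≤ c n) {t : ℝ} (ht : 0 < t) : InCone (phiVec R s A a x f c t) :=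
  inCone_conv hf (phi_nonneg hRpos hc ht)

theorem ofReal_phiVec_apply [Finite W] (hRpos : ∀ y, 0 < R y) (hf : InCone f) {c : ℕ → ℝ}
    (hc : ∀ n, 0 ≤ c n) {t : ℝ} (ht : 0 < t)
    (h : normSq R s f (coeff c t) (startingWith A : Set (InverseBranch a x)) ≠ ∞)
    (q : Σ i, G ⧸ H i) :
    ENNReal.ofReal (phiVec R s A a x f c t q) =
      series R s f (coeff c t) (startingWith A : Set (InverseBranch a x)) q := by
  rcases eq_or_ne f 0 with rfl | hf0
  · simp [phiVec, conv, series]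
  have hnonneg := phi_nonneg (s := s) (A := A) (a := a) (x := x) hRpos hc ht
  have hphi := fun g => ofReal_phi hRpos hc ht (groupWeight_ne_top hf hf0 h g)
  refine ofReal_conv_apply hf hnonneg
    (summable_of_tsum_sq_ne_top (fun g => inCone_smul_rho hf hnonneg g) ?_) hphi q
  simp_rw [ofReal_smul_rho hnonneg, hphi, ← series_eq_tsum_groupWeight]
  exact h

theorem ofReal_inner_phiVec [Finite W] (hRpos : ∀ y, 0 < R y) (hf : InCone f) {c : ℕ → ℝ}
    (hc : ∀ n, 0 ≤ c n) {t : ℝ} (ht : 0 < t)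
    (h : normSq R s f (coeff c t) (startingWith A : Set (InverseBranch a x)) ≠ ∞) :
    ENNReal.ofReal (inner ℝ (phiVec R s A a x f c t) (phiVec R s A a x f c t)) =
      normSq R s f (coeff c t) (startingWith A : Set (InverseBranch a x)) := by
  have hcone : InCone (phiVec R s A a x f c t) := inCone_phiVec hRpos hf hc ht
  rw [ofReal_inner_eq_tsum hcone hcone, normSq]
  simp_rw [ofReal_phiVec_apply hRpos hf hc ht h, sq]

end PhiVec

/-! ### Slowly increasing weights -/

section SlowlyIncreasing

variable {c : ℕ → ℝ}

theorem slowlyIncreasing_one : SlowlyIncreasing fun _ => 1 where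
  pos _ := one_pos
  mono := monotone_const
  slow _ := by simp only [div_one]; exact tendsto_const_nhds

theorem SlowlyIncreasing.nonneg (hc : SlowlyIncreasing c) (n : ℕ) : 0 ≤ c n :=
  (hc.pos n).le

theorem SlowlyIncreasing.exists_le_mul_pow (hc : SlowlyIncreasing c) {l : ℝ}
    (hl : 1 < l) : ∃ C : ℝ, 0 < C ∧ ∀ n, c n ≤ C * l ^ n := by
  obtain ⟨N, hN⟩ := eventually_atTop.1 ((hc.slow 1).eventually_le_const hl)
  refine ⟨c N, hc.pos N, fun n => ?_⟩
  rcases le_total n N with h | h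
  · exact (hc.mono h).trans (le_mul_of_one_le_right (hc.nonneg N) (one_le_pow₀ hl.le))
  · induction n, h using Nat.le_induction with
    | base => exact le_mul_of_one_le_right (hc.nonneg N) (one_le_pow₀ hl.le)
    | succ n h ih =>
      calc c (n + 1) ≤ l * c n := (div_le_iff₀ (hc.pos n)).1 (hN n h)
        _ ≤ l * (c N * l ^ n) := by gcongr
        _ = c N * l ^ (n + 1) := by ring

theorem slowlyIncreasing_prod {u : ℕ → ℝ} (hu : ∀ n, 0 ≤ u n) (hlim : Tendsto u atTop (𝓝 0)) :
    SlowlyIncreasing fun n => ∏ i ∈ Finset.range n, (1 + u i) := by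
  let c : ℕ → ℝ := fun n => ∏ i ∈ Finset.range n, (1 + u i)
  have hpos : ∀ n, 0 < c n := fun n => Finset.prod_pos fun i _ => by linarith [hu i]
  have hsucc : ∀ n, c (n + 1) = c n * (1 + u n) := fun n => Finset.prod_range_succ _ _
  have hratio : Tendsto (fun n => c (n + 1) / c n) atTop (𝓝 1) := by
    have hlim1 := hlim.const_add 1
    rw [add_zero] at hlim1
    exact hlim1.congr fun n => by rw [hsucc, mul_div_cancel_left₀ _ (hpos n).ne']
  refine ⟨hpos, monotone_nat_of_le_succ fun n => ?_, fun k => ?_⟩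
  · exact (le_mul_of_one_le_right (hpos n).le (by linarith [hu n])).trans_eq (hsucc n).symm
  · induction k with
    | zero => exact tendsto_const_nhds.congr fun n => (div_self (hpos n).ne').symm
    | succ k ih =>
      have hmul := (hratio.comp (tendsto_add_atTop_nat k)).mul ih
      rw [one_mul] at hmul
      exact hmul.congr fun n => div_mul_div_cancel₀ (hpos _).ne'

theorem exists_tendsto_atTop_le_of_lt (M : ℕ → ℕ) :
    ∃ J : ℕ → ℕ, Tendsto J atTop atTop ∧ ∀ i j, i < M j → J i ≤ j := by
  have hex : ∀ i, ∃ j, i < max (M j) (j + 1) := fun i => ⟨i, by simp⟩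
  refine ⟨fun i => Nat.find (hex i), tendsto_atTop.2 fun m => ?_, fun i j h =>
    Nat.find_min' (hex i) (h.trans_le (le_max_left _ _))⟩
  filter_upwards [eventually_ge_atTop ((Finset.range m).sup fun j => max (M j) (j + 1))] with i hi
  refine (Nat.le_find_iff (hex i) m).2 fun j hj => not_lt.2 (le_trans ?_ hi)
  exact Finset.le_sup (f := fun j => max (M j) (j + 1)) (Finset.mem_range.2 hj)

theorem exists_slowlyIncreasing_ge (M : ℕ → ℕ) :
    ∃ c : ℕ → ℝ, SlowlyIncreasing c ∧
      ∀ j : ℕ, ∀ n ≤ M j, (1 + 1 / ((j : ℝ) + 1)) ^ n ≤ c n := by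
  obtain ⟨J, hJ, hJM⟩ := exists_tendsto_atTop_le_of_lt M
  refine ⟨_, slowlyIncreasing_prod (u := fun i => 1 / ((J i : ℝ) + 1)) (fun i => by positivity)
    (tendsto_one_div_add_atTop_nhds_zero_nat.comp hJ), fun j n hn => ?_⟩
  calc (1 + 1 / ((j : ℝ) + 1)) ^ n = ∏ i ∈ Finset.range n, (1 + 1 / ((j : ℝ) + 1)) := by
        rw [Finset.prod_const, Finset.card_range]
    _ ≤ ∏ i ∈ Finset.range n, (1 + 1 / ((J i : ℝ) + 1)) := by
        refine Finset.prod_le_prod (fun i _ => by positivity) fun i hi => ?_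
        have := hJM i j ((Finset.mem_range.1 hi).trans_le hn)
        gcongr

end SlowlyIncreasing

/-! ### The decay exponent -/

section Exponent

open InverseBranch

variable {W : Type*} {τ : W → W → Prop} {G : Type*} [Group G] {I : Type*} {H : I → Subgroup G}
  {R : MarkovShift τ → ℝ} {s : W → G} {A a : W} {x : MarkovShift τ} {f : QuotientSum H}

/-- The point `ax`. -/
def cons (a : W) (x : MarkovShift τ) (hx : τ a (x.1 0)) : MarkovShift τ :=
  ⟨fun i => Nat.casesOn i a fun j => x.1 j, fun i => by
    cases i with
    | zero => exact hx
    | succ i => exact x.2 i⟩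

theorem shift_cons (hx : τ a (x.1 0)) : shift (cons a x hx) = x := rfl

theorem exists_mem_startingWith_value_eq (hs : WordsConnect τ s) (hx : τ a (x.1 0)) (A : W)
    (g : G) : ∃ p ∈ (startingWith A : Set (InverseBranch a x)), p.value s = g := by
  obtain ⟨z, k, rfl, hzk, hval⟩ := hs A a (g * (s a)⁻¹)
  have hzk' : z.1 k = (cons a x hx).1 0 := hzk
  refine ⟨⟨k + 1, glue z k (cons a x hx) hzk', Nat.succ_pos _, ?_, ?_⟩,
    glue_apply_of_le hzk' k.zero_le, ?_⟩
  · rw [Function.iterate_succ_apply', shift_iterate_glue, shift_cons]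
  · exact (glue_apply_of_le hzk' le_rfl).trans hzk
  · have hz : glue z k (cons a x hx) hzk' ∈ cylinder z (0 + k) := fun i hi =>
      glue_apply_of_le hzk' (by omega)
    change wordValue s (glue z k (cons a x hx) hzk') 0 (k + 1) = g
    rw [wordValue_add, shift_iterate_glue, wordValue_congr s hz, hval, wordValue_succ,
      wordValue_zero, mul_one]
    exact inv_mul_cancel_right g (s a)

theorem exists_mem_startingWith_le_length (hs : WordsConnect τ s) (hx : τ a (x.1 0)) (A : W)
    (M : ℕ) : ∃ p ∈ (startingWith A : Set (InverseBranch a x)), M ≤ p.length := by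
  obtain ⟨y, -, rfl, -⟩ := hs A A 1
  obtain ⟨p, hp, -⟩ := exists_mem_startingWith_value_eq hs hx (y.1 M) 1
  exact ⟨p.prepend y M hp.symm, glue_apply_of_le hp.symm M.zero_le, Nat.le_add_left _ _⟩

theorem ofReal_sq_le_normSq {r : ℝ} (hr : 0 < r) (hRr : ∀ y, r ≤ R y) {t : ℝ} (ht : 0 < t)
    (q : Σ i, G ⧸ H i) {P : Set (InverseBranch a x)} {p : InverseBranch a x} (hp : p ∈ P) :
    ENNReal.ofReal ((r / t) ^ p.length * f q) ^ 2 ≤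
      normSq R s f (coeff (fun _ => 1) t) P := by
  have hterm : ENNReal.ofReal ((r / t) ^ p.length * f q) ≤
      p.weight R (coeff (fun _ => 1) t) *
        ENNReal.ofReal (f ((p.value s)⁻¹ • p.value s • q)) := by
    rw [inv_smul_smul, weight, coeff, ← ENNReal.ofReal_mul (by positivity),
      ENNReal.ofReal_mul (by positivity), div_pow, mul_one, div_eq_inv_mul]
    gcongr
    exact pow_le_birkhoffProd hr.le hRr _ _
  refine le_trans (pow_le_pow_left' ?_ 2) (ENNReal.le_tsum (p.value s • q))
  exact hterm.trans (ENNReal.le_tsum (⟨p, hp⟩ : P))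

theorem normSq_eq_top_of_lt (hs : WordsConnect τ s) (hx : τ a (x.1 0)) {r : ℝ} (hr : 0 < r)
    (hRr : ∀ y, r ≤ R y) (hf : InCone f) (hf0 : f ≠ 0) {t : ℝ} (ht : 0 < t) (htr : t < r) :
    normSq R s f (coeff (fun _ => 1) t) (startingWith A : Set (InverseBranch a x)) = ∞ := by
  obtain ⟨q, hq⟩ := exists_pos_of_ne_zero hf hf0
  have hlim : Tendsto (fun m : ℕ => ENNReal.ofReal ((r / t) ^ m * f q) ^ 2) atTop (𝓝 (∞ ^ 2)) :=
    ((ENNReal.continuous_pow 2).tendsto ∞).comp (ENNReal.tendsto_ofReal_nhds_top.2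
      ((tendsto_pow_atTop_atTop_of_one_lt ((one_lt_div ht).2 htr)).atTop_mul_const hq))
  rw [ENNReal.top_pow two_ne_zero] at hlim
  refine top_unique (le_of_tendsto hlim (Eventually.of_forall fun m => ?_))
  obtain ⟨p, hp, hmp⟩ := exists_mem_startingWith_le_length hs hx A m
  refine le_trans ?_ (ofReal_sq_le_normSq hr hRr ht q hp)
  gcongr
  exact ((one_le_div ht).2 htr.le)

theorem tsum_weight_length_eq_le [Fintype W] (hRpos : ∀ y, 0 < R y) {r : ℝ} (hRr : ∀ y, R y ≤ r)
    (b : ℕ → ℝ≥0∞) (n : ℕ) :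
    ∑' p : {p : InverseBranch a x // p.length = n}, p.1.weight R b ≤
      Fintype.card W ^ n * (b n * ENNReal.ofReal (r ^ n)) := by
  calc ∑' p : {p : InverseBranch a x // p.length = n}, p.1.weight R b
      ≤ 1 * ∑' _ : Fin n → W, b n * ENNReal.ofReal (r ^ n) := by
        refine tsum_le_mul_tsum_of_injective (injective_prefix_of_length_eq n) ?_
        rintro ⟨p, rfl⟩
        rw [one_mul, weight]
        gcongr
        exact birkhoffProd_le_pow (fun y => (hRpos y).le) hRr _ _
    _ = Fintype.card W ^ n * (b n * ENNReal.ofReal (r ^ n)) := by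
        rw [one_mul, tsum_fintype, Finset.sum_const, Finset.card_univ, Fintype.card_fun,
          Fintype.card_fin, nsmul_eq_mul, Nat.cast_pow]

theorem exists_tsum_weight_ne_top [Finite W] (hRpos : ∀ y, 0 < R y) {r : ℝ} (hRr : ∀ y, R y ≤ r) :
    ∃ t : ℝ, 0 < t ∧ ∑' p : InverseBranch a x, p.weight R (coeff (fun _ => 1) t) ≠ ∞ := by
  have := Fintype.ofFinite W
  have : Nonempty W := ⟨a⟩
  have hr : 0 < r := (hRpos x).trans_le (hRr x)
  have hW : (0 : ℝ) < Fintype.card W := mod_cast Fintype.card_pos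
  refine ⟨2 * (Fintype.card W * r), by positivity, ?_⟩
  rw [← ENNReal.tsum_fiberwise _ length]
  refine ne_top_of_le_ne_top ?_ (ENNReal.tsum_le_tsum fun n =>
    tsum_weight_length_eq_le (a := a) (x := x) hRpos hRr _ n)
  have hterm : ∀ n : ℕ, (Fintype.card W : ℝ≥0∞) ^ n *
      (coeff (fun _ => 1) (2 * (Fintype.card W * r)) n * ENNReal.ofReal (r ^ n)) =
      ENNReal.ofReal ((1 / 2) ^ n) := fun n => by
    rw [coeff, ← ENNReal.ofReal_natCast, ← ENNReal.ofReal_pow hW.le,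
      ← ENNReal.ofReal_mul (by positivity), ← ENNReal.ofReal_mul (by positivity)]
    congr 1
    rw [mul_pow, mul_pow, one_div_pow]
    field_simp
  simp_rw [hterm]
  rw [← ENNReal.ofReal_tsum_of_nonneg (fun n => by positivity) summable_geometric_two]
  exact ENNReal.ofReal_ne_top

theorem exists_normSq_ne_top [Finite W] (hRpos : ∀ y, 0 < R y) {r : ℝ} (hRr : ∀ y, R y ≤ r)
    (hf : InCone f) (P : Set (InverseBranch a x)) :
    ∃ t : ℝ, 0 < t ∧ normSq R s f (coeff (fun _ => 1) t) P ≠ ∞ := by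
  obtain ⟨t, ht, hfin⟩ := exists_tsum_weight_ne_top (a := a) (x := x) hRpos hRr
  exact ⟨t, ht, normSq_ne_top hf (ne_top_of_le_ne_top hfin
    (ENNReal.tsum_comp_le_tsum_of_injective Subtype.val_injective _))⟩

theorem decayExponent_eq [Finite W] (hRpos : ∀ y, 0 < R y) (hf : InCone f) :
    decayExponent R s A a x f = sInf {t : ℝ | 0 < t ∧
      normSq R s f (coeff (fun _ => 1) t) (startingWith A : Set (InverseBranch a x)) ≠ ∞} := by
  rw [decayExponent]
  congr 1
  ext t
  exact and_congr_right fun ht => bddAbove_iff_normSq_ne_top hRpos hf slowlyIncreasing_one.nonneg ht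

theorem decayExponent_pos [Finite W] (hs : WordsConnect τ s) (hx : τ a (x.1 0))
    (hR : IsRegularPotential R) (hf : InCone f) (hf0 : f ≠ 0) :
    0 < decayExponent R s A a x f := by
  obtain ⟨r, hr, hRr⟩ := hR.exists_lower
  obtain ⟨r', hRr'⟩ := hR.exists_upper
  rw [decayExponent_eq hR.pos hf]
  refine hr.trans_le (le_csInf (exists_normSq_ne_top hR.pos hRr' hf _) fun t ht => ?_)
  by_contra! hlt
  exact ht.2 (normSq_eq_top_of_lt hs hx hr hRr hf hf0 ht.1 hlt)

theorem normSq_coeff_one_eq_top [Finite W] (hRpos : ∀ y, 0 < R y) (hf : InCone f) {t : ℝ}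
    (ht : 0 < t) (hlt : t < decayExponent R s A a x f) :
    normSq R s f (coeff (fun _ => 1) t) (startingWith A : Set (InverseBranch a x)) = ∞ := by
  rw [decayExponent_eq hRpos hf] at hlt
  by_contra h
  exact notMem_of_lt_csInf hlt ⟨0, fun u hu => hu.1.le⟩ ⟨ht, h⟩

theorem normSq_coeff_ne_top [Finite W] (hR : IsRegularPotential R)
    (hf : InCone f) {c : ℕ → ℝ} (hc : SlowlyIncreasing c) {t : ℝ}
    (hlt : decayExponent R s A a x f < t) :
    normSq R s f (coeff c t) (startingWith A : Set (InverseBranch a x)) ≠ ∞ := by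
  obtain ⟨r, hRr⟩ := hR.exists_upper
  rw [decayExponent_eq hR.pos hf] at hlt
  obtain ⟨u, ⟨hu, hfin⟩, hut⟩ :=
    exists_lt_of_csInf_lt (exists_normSq_ne_top hR.pos hRr hf _) hlt
  obtain ⟨C, hC, hle⟩ := hc.exists_le_mul_pow ((one_lt_div hu).2 hut)
  have ht : 0 < t := hu.trans hut
  have hcoeff : ∀ n, coeff c t n ≤ ENNReal.ofReal C * coeff (fun _ => 1) u n := fun n => by
    rw [coeff, coeff, ← ENNReal.ofReal_mul hC.le]
    refine ENNReal.ofReal_le_ofReal ?_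
    calc (t ^ n)⁻¹ * c n ≤ (t ^ n)⁻¹ * (C * (t / u) ^ n) := by gcongr; exact hle n
      _ = C * ((u ^ n)⁻¹ * 1) := by rw [div_pow]; field_simp
  exact ne_top_of_le_ne_top (ENNReal.mul_ne_top (ENNReal.pow_ne_top ENNReal.ofReal_ne_top) hfin)
    (normSq_le_mul fun p _ => hcoeff p.length)

theorem exists_lt_normSq_startingWithUpTo {b : ℕ → ℝ≥0∞}
    (h : normSq R s f b (startingWith A : Set (InverseBranch a x)) = ∞) {K : ℝ≥0∞} (hK : K < ∞) :
    ∃ N, K < normSq R s f b (startingWithUpTo A N : Set (InverseBranch a x)) := by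
  rw [normSq_startingWith_eq_iSup] at h
  exact lt_iSup_iff.1 (by rwa [h])

/- The weights are chosen so large up to the thresholds `M j` that the series at `γ` with weights
`c` dominates, for every `j`, a partial sum exceeding `j` of the unweighted series at
`γ / (1 + 1 / (j + 1))`. -/
theorem exists_slowlyIncreasing_normSq_eq_top [Finite W] (hRpos : ∀ y, 0 < R y) (hf : InCone f)
    (hγ : 0 < decayExponent R s A a x f) :
    ∃ c : ℕ → ℝ, SlowlyIncreasing c ∧ normSq R s f (coeff c (decayExponent R s A a x f))
      (startingWith A : Set (InverseBranch a x)) = ∞ := by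
  let γ := decayExponent R s A a x f
  have hex : ∀ j : ℕ, ∃ N : ℕ, (j : ℝ≥0∞) <
      normSq R s f (coeff (fun _ => 1) (γ / (1 + 1 / ((j : ℝ) + 1))))
        (startingWithUpTo A N : Set (InverseBranch a x)) := fun j =>
    exists_lt_normSq_startingWithUpTo (normSq_coeff_one_eq_top hRpos hf (by positivity)
      (div_lt_self hγ (lt_add_of_pos_right _ (by positivity)))) (ENNReal.natCast_lt_top j)
  choose M hM using hex
  obtain ⟨c, hc, hge⟩ := exists_slowlyIncreasing_ge M
  have hcoeff : ∀ j, ∀ n ≤ M j, coeff (fun _ => 1) (γ / (1 + 1 / ((j : ℝ) + 1))) n ≤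
      1 * coeff c γ n := fun j n hn => by
    rw [one_mul]
    refine ENNReal.ofReal_le_ofReal ?_
    rw [div_pow, inv_div, mul_one, div_eq_inv_mul]
    gcongr
    exact hge j n hn
  refine ⟨c, hc, ENNReal.eq_top_of_forall_nnreal_le fun K => ?_⟩
  obtain ⟨j, hj⟩ := exists_nat_ge K
  calc (K : ℝ≥0∞) ≤ j := mod_cast hj
    _ ≤ _ := (hM j).le
    _ ≤ 1 ^ 2 * normSq R s f (coeff c γ) _ := normSq_le_mul fun p hp => hcoeff j _ hp.2
    _ = normSq R s f (coeff c γ) _ := by rw [one_pow, one_mul]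
    _ ≤ _ := normSq_mono _ (startingWithUpTo_subset A _)

theorem eventually_coeff_le_two_mul {γ : ℝ} (hγ : 0 < γ) {c : ℕ → ℝ} (hc : ∀ n, 0 ≤ c n) (N : ℕ) :
    ∀ᶠ t in 𝓝[>] γ, ∀ n ≤ N, coeff c γ n ≤ 2 * coeff c t n := by
  have hlim : Tendsto (fun t : ℝ => (t / γ) ^ N) (𝓝[>] γ) (𝓝 ((γ / γ) ^ N)) :=
    (((continuous_id.div_const γ).pow N).tendsto γ).mono_left nhdsWithin_le_nhds
  rw [div_self hγ.ne', one_pow] at hlim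
  filter_upwards [hlim.eventually_le_const one_lt_two, self_mem_nhdsWithin] with t hN hγt n hn
  have ht : 0 < t := hγ.trans hγt
  have hpow : (t / γ) ^ n ≤ 2 :=
    (pow_le_pow_right₀ ((one_le_div hγ).2 (Set.mem_Ioi.1 hγt).le) hn).trans hN
  rw [coeff, coeff, ← ENNReal.ofReal_ofNat, ← ENNReal.ofReal_mul zero_le_two, ← mul_assoc]
  refine ENNReal.ofReal_le_ofReal (mul_le_mul_of_nonneg_right ?_ (hc n))
  rw [div_pow, div_le_iff₀ (by positivity)] at hpow
  rw [← div_eq_mul_inv, le_div_iff₀ (by positivity), inv_mul_le_iff₀ (by positivity), mul_comm]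
  exact hpow

theorem tendsto_inner_phiVec_atTop [Finite W] (hR : IsRegularPotential R) (hf : InCone f)
    {c : ℕ → ℝ} (hc : SlowlyIncreasing c) (hγ : 0 < decayExponent R s A a x f)
    (htop : normSq R s f (coeff c (decayExponent R s A a x f))
      (startingWith A : Set (InverseBranch a x)) = ∞) :
    Tendsto (fun u : ℝ => inner ℝ (phiVec R s A a x f c u) (phiVec R s A a x f c u))
      (𝓝[>] (decayExponent R s A a x f)) atTop := by
  refine tendsto_atTop.2 fun K => ?_
  obtain ⟨N, hN⟩ := exists_lt_normSq_startingWithUpTo htop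
    (show 2 ^ 2 * ENNReal.ofReal K < ∞ from ENNReal.mul_lt_top (by norm_num) ENNReal.ofReal_lt_top)
  filter_upwards [eventually_coeff_le_two_mul hγ hc.nonneg N, self_mem_nhdsWithin] with t ht hγt
  have hle := calc 2 ^ 2 * ENNReal.ofReal K
      ≤ 2 ^ 2 * normSq R s f (coeff c t) (startingWithUpTo A N : Set (InverseBranch a x)) :=
        hN.le.trans (normSq_le_mul fun p hp => ht p.length hp.2)
    _ ≤ 2 ^ 2 * normSq R s f (coeff c t) (startingWith A : Set (InverseBranch a x)) := by
        gcongr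
        exact normSq_mono _ (startingWithUpTo_subset A N)
  rw [ENNReal.mul_le_mul_iff_right (by norm_num) (by norm_num), ← ofReal_inner_phiVec hR.pos hf
    hc.nonneg (hγ.trans hγt) (normSq_coeff_ne_top hR hf hc hγt)] at hle
  exact (ENNReal.ofReal_le_ofReal_iff real_inner_self_nonneg).1 hle

end Exponent

/-! ### The approximating measures -/

section Approx

open InverseBranch

variable {W : Type*} {τ : W → W → Prop} {G : Type*} [Group G] {I : Type*} {H : I → Subgroup G}
  {R : MarkovShift τ → ℝ} {s : W → G} {A a : W} {x : MarkovShift τ} {f v : QuotientSum H}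

theorem inCone_rho (hv : InCone v) (g : G) : InCone (rho H g v) :=
  fun q => hv (g⁻¹ • q)

theorem ofReal_inner_rho_self (hv : InCone v) (g : G) :
    ENNReal.ofReal (inner ℝ (rho H g v) v) =
      ∑' q, ENNReal.ofReal (v (g⁻¹ • q)) * ENNReal.ofReal (v q) :=
  ofReal_inner_eq_tsum (inCone_rho hv g) hv

theorem tsum_series_mul (hf : InCone f) (hv : InCone v) (b : ℕ → ℝ≥0∞)
    (P : Set (InverseBranch a x)) :
    ∑' q, series R s f b P q * ENNReal.ofReal (v q) =
      ∑' p : P, p.1.weight R b * ENNReal.ofReal (inner ℝ (rho H (p.1.value s) f) v) := by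
  simp_rw [series, ← ENNReal.tsum_mul_right]
  rw [ENNReal.tsum_comm]
  refine tsum_congr fun p => ?_
  rw [ofReal_inner_eq_tsum (inCone_rho hf _) hv, ← ENNReal.tsum_mul_left]
  exact tsum_congr fun q => mul_assoc _ _ _

theorem tsum_series_mul_le (hf : InCone f) (hv : InCone v) (b : ℕ → ℝ≥0∞)
    (P : Set (InverseBranch a x)) :
    ∑' q, series R s f b P q * ENNReal.ofReal (v q) ≤
      (∑' p : P, p.1.weight R b) * ENNReal.ofReal (‖f‖ * ‖v‖) := by
  rw [tsum_series_mul hf hv, ← ENNReal.tsum_mul_right]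
  refine ENNReal.tsum_le_tsum fun p => ?_
  gcongr
  refine (real_inner_le_norm _ _).trans_eq ?_
  rw [LinearIsometryEquiv.norm_map]

theorem tsum_series_tail_mul_le (hRpos : ∀ y, 0 < R y) {D : ℝ} (hD : HasDistortion R D)
    (z : MarkovShift τ) (n N : ℕ) {b : ℕ → ℝ≥0∞} {K : ℝ≥0∞} (hb : ∀ m ≥ N, b (m + n) ≤ K * b m)
    (hv : InCone v) {C : ℝ≥0∞} (hC : ∀ q, series R s f b (Set.univ : Set (InverseBranch a x)) q ≤
      C * ENNReal.ofReal (v q)) :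
    ∑' q, series R s f b {p : InverseBranch a x | N + n < p.length ∧ p.point ∈ cylinder z n} q *
        ENNReal.ofReal (v q) ≤
      K * ENNReal.ofReal (D * birkhoffProd R n z) * C *
        ENNReal.ofReal (inner ℝ (rho H (wordValue s z 0 n) v) v) := by
  rw [ofReal_inner_rho_self hv, ← ENNReal.tsum_mul_left]
  refine ENNReal.tsum_le_tsum fun q => ?_
  rw [← mul_assoc, mul_assoc _ C]
  gcongr
  exact (series_cylinder_le hRpos hD z n N hb q).trans (mul_le_mul_right (hC _) _)

/- Deleting the first `n` letters controls the long words; the finitely many short ones only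
contribute a multiple of `‖v‖`, which is negligible against `‖v‖ ^ 2`. -/
theorem tsum_series_cylinder_mul_le (hRpos : ∀ y, 0 < R y) {D : ℝ} (hD : HasDistortion R D)
    (z : MarkovShift τ) (n N : ℕ) {b : ℕ → ℝ≥0∞} {K : ℝ≥0∞} (hb : ∀ m ≥ N, b (m + n) ≤ K * b m)
    (hf : InCone f) (hv : InCone v) {C : ℝ≥0∞}
    (hC : ∀ q, series R s f b (Set.univ : Set (InverseBranch a x)) q ≤
      C * ENNReal.ofReal (v q)) :
    ∑' q, series R s f b {p : InverseBranch a x | p.point ∈ cylinder z n} q *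
        ENNReal.ofReal (v q) ≤
      (∑' p : {p : InverseBranch a x | p.length ≤ N + n}, p.1.weight R b) *
          ENNReal.ofReal (‖f‖ * ‖v‖) +
        K * ENNReal.ofReal (D * birkhoffProd R n z) * C *
          ENNReal.ofReal (inner ℝ (rho H (wordValue s z 0 n) v) v) := by
  let short := {p : InverseBranch a x | p.length ≤ N + n}
  let long := {p : InverseBranch a x | N + n < p.length ∧ p.point ∈ cylinder z n}
  have hsub : {p : InverseBranch a x | p.point ∈ cylinder z n} ⊆ short ∪ long := fun p hp =>
    (le_or_gt p.length (N + n)).imp id fun h => ⟨h, hp⟩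
  have hsplit : ∀ q, series R s f b {p : InverseBranch a x | p.point ∈ cylinder z n} q ≤
      series R s f b short q + series R s f b long q := fun q =>
    (series_mono b hsub q).trans (ENNReal.tsum_union_le
      (fun p : InverseBranch a x => p.weight R b * ENNReal.ofReal (f ((p.value s)⁻¹ • q))) _ _)
  refine (ENNReal.tsum_le_tsum fun q => mul_le_mul_left (hsplit q) _).trans ?_
  simp_rw [add_mul]
  rw [ENNReal.tsum_add]
  exact add_le_add (tsum_series_mul_le hf hv b short)
    (tsum_series_tail_mul_le hRpos hD z n N hb hv hC)

theorem approxMeasure_apply [MeasurableSpace W] (hRpos : ∀ y, 0 < R y) (hf : InCone f)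
    {c : ℕ → ℝ} (hc : ∀ n, 0 ≤ c n) {t : ℝ} (ht : 0 < t)
    (hpos : 0 < inner ℝ (phiVec R s A a x f c t) (phiVec R s A a x f c t))
    {S : Set (MarkovShift τ)} (hS : MeasurableSet S) :
    approxMeasure R s A a x f c t S =
      (∑' q, series R s f (coeff c t) {p : InverseBranch a x | p.point ∈ S} q *
        ENNReal.ofReal (phiVec R s A a x f c t q)) /
      ENNReal.ofReal (inner ℝ (phiVec R s A a x f c t) (phiVec R s A a x f c t)) := by
  rw [tsum_series_mul hf (inCone_phiVec hRpos hf hc ht), div_eq_mul_inv, ← ENNReal.tsum_mul_right,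
    tsum_subtype {p : InverseBranch a x | p.point ∈ S} fun p => p.weight R (coeff c t) *
      ENNReal.ofReal (inner ℝ (rho H (p.value s) f) (phiVec R s A a x f c t)) * _,
    ← (equivSigma a x).symm.tsum_eq, ENNReal.tsum_sigma', approxMeasure, Measure.sum_apply _ hS]
  refine tsum_congr fun n => ?_
  rw [Measure.sum_apply _ hS]
  refine tsum_congr fun y => ?_
  rw [Measure.smul_apply, Measure.dirac_apply' _ hS, smul_eq_mul]
  have hcoeff : 0 ≤ (t ^ (n + 1))⁻¹ * c (n + 1) := mul_nonneg (by positivity) (hc _)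
  by_cases hy : y.1 ∈ S
  · rw [Set.indicator_of_mem hy,
      Set.indicator_of_mem (show _ ∈ {p : InverseBranch a x | p.point ∈ S} from hy),
      Pi.one_apply, mul_one,
      ENNReal.ofReal_mul (mul_nonneg hcoeff (birkhoffProd_pos hRpos _ _).le),
      ENNReal.ofReal_mul hcoeff, ENNReal.ofReal_div_of_pos hpos, div_eq_mul_inv, ← mul_assoc]
    rfl
  · rw [Set.indicator_of_notMem hy,
      Set.indicator_of_notMem (show _ ∉ {p : InverseBranch a x | p.point ∈ S} from hy),
      mul_zero]

theorem coeff_le_coeff {c : ℕ → ℝ} (hc : ∀ n, 0 ≤ c n) {t u : ℝ} (hu : 0 < u) (hut : u ≤ t)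
    (n : ℕ) : coeff c t n ≤ coeff c u n := by
  refine ENNReal.ofReal_le_ofReal ?_
  have := hc n
  gcongr

theorem coeff_add_le {c : ℕ → ℝ} {t : ℝ} (ht : 0 < t) {K : ℝ} (hK : 0 ≤ K) {m n : ℕ}
    (h : c (m + n) ≤ K * c m) :
    coeff c t (m + n) ≤ ENNReal.ofReal (K * (t ^ n)⁻¹) * coeff c t m := by
  rw [coeff, coeff, ← ENNReal.ofReal_mul (by positivity)]
  refine ENNReal.ofReal_le_ofReal ?_
  calc (t ^ (m + n))⁻¹ * c (m + n) ≤ (t ^ (m + n))⁻¹ * (K * c m) := by gcongr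
    _ = K * (t ^ n)⁻¹ * ((t ^ m)⁻¹ * c m) := by rw [pow_add, mul_inv]; ring

theorem coeff_le_mul_succ {c : ℕ → ℝ} (hc : SlowlyIncreasing c) {t T : ℝ} (ht : 0 < t)
    (htT : t ≤ T) (n : ℕ) : coeff c t n ≤ ENNReal.ofReal T * coeff c t (n + 1) := by
  rw [coeff, coeff, ← ENNReal.ofReal_mul (ht.le.trans htT)]
  refine ENNReal.ofReal_le_ofReal ?_
  have h0 := hc.nonneg (n + 1)
  calc (t ^ n)⁻¹ * c n ≤ (t ^ n)⁻¹ * c (n + 1) := by gcongr; exact hc.mono (Nat.le_succ n)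
    _ = t * ((t ^ (n + 1))⁻¹ * c (n + 1)) := by rw [pow_succ]; field_simp
    _ ≤ _ := by gcongr

theorem measurable_letter [MeasurableSpace W] (i : ℕ) :
    Measurable fun y : MarkovShift τ => y.1 i :=
  (measurable_pi_apply i).comp measurable_subtype_coe

theorem measurableSet_cylinder [MeasurableSpace W] [MeasurableSingletonClass W]
    (z : MarkovShift τ) (n : ℕ) : MeasurableSet (cylinder z n) := by
  rw [show cylinder z n = ⋂ i ∈ Set.Iio n, (fun y : MarkovShift τ => y.1 i) ⁻¹' {z.1 i} by
    ext y; simp [cylinder]]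
  exact MeasurableSet.biInter (Set.finite_Iio n).countable fun i _ =>
    measurable_letter i (measurableSet_singleton _)

theorem approxMeasure_cylinder_le [MeasurableSpace W] [MeasurableSingletonClass W]
    (hRpos : ∀ y, 0 < R y) {D : ℝ} (hD : HasDistortion R D) (hf : InCone f) {c : ℕ → ℝ}
    (hc : ∀ n, 0 ≤ c n) {t u : ℝ} (hu : 0 < u) (hut : u ≤ t)
    (hpos : 0 < inner ℝ (phiVec R s A a x f c t) (phiVec R s A a x f c t))
    {C : ℝ} (hC0 : 0 ≤ C)
    (hC : ∀ q, series R s f (coeff c t) (Set.univ : Set (InverseBranch a x)) q ≤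
      ENNReal.ofReal C * ENNReal.ofReal (phiVec R s A a x f c t q))
    (z : MarkovShift τ) (n N : ℕ) (hN : ∀ m ≥ N, c (m + n) ≤ 2 * c m) {w : ℝ} (hw0 : 0 ≤ w)
    (hw : ∑' p : {p : InverseBranch a x | p.length ≤ N + n}, p.1.weight R (coeff c u) ≤
      ENNReal.ofReal w) :
    approxMeasure R s A a x f c t (cylinder z n) ≤ ENNReal.ofReal
      (w * ‖f‖ / ‖phiVec R s A a x f c t‖ + 2 * (t ^ n)⁻¹ * (D * birkhoffProd R n z) * C *
        matrixCoeff R s A a x f c t (wordValue s z 0 n)) := by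
  have ht : 0 < t := hu.trans_le hut
  have hQ := inCone_phiVec (s := s) (A := A) (a := a) (x := x) hRpos hf hc ht
  rw [matrixCoeff]
  set Q := phiVec R s A a x f c t
  have hD0 : 0 ≤ D := zero_le_one.trans (hD.one_le z)
  have hRn := (birkhoffProd_pos hRpos n z).le
  have hin := inner_nonneg_of_nonneg (inCone_rho hQ (wordValue s z 0 n)) hQ
  have hshort : ∑' p : {p : InverseBranch a x | p.length ≤ N + n}, p.1.weight R (coeff c t) ≤
      ENNReal.ofReal w := (ENNReal.tsum_le_tsum fun p =>
    mul_le_mul_left (coeff_le_coeff hc hu hut _) _).trans hw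
  have hsum : ∑' q, series R s f (coeff c t) {p : InverseBranch a x | p.point ∈ cylinder z n} q *
        ENNReal.ofReal (Q q) ≤ ENNReal.ofReal (w * (‖f‖ * ‖Q‖) +
        2 * (t ^ n)⁻¹ * (D * birkhoffProd R n z) * C *
          inner ℝ (rho H (wordValue s z 0 n) Q) Q) := by
    refine (tsum_series_cylinder_mul_le hRpos hD z n N
      (fun m hm => coeff_add_le ht zero_le_two (hN m hm)) hf hQ hC).trans ?_
    rw [ENNReal.ofReal_add (by positivity) (by positivity), ENNReal.ofReal_mul hw0,
      ENNReal.ofReal_mul (p := 2 * (t ^ n)⁻¹ * (D * birkhoffProd R n z) * C) (by positivity),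
      ENNReal.ofReal_mul (p := 2 * (t ^ n)⁻¹ * (D * birkhoffProd R n z)) (by positivity),
      ENNReal.ofReal_mul (p := 2 * (t ^ n)⁻¹) (by positivity)]
    gcongr
  rw [approxMeasure_apply hRpos hf hc ht hpos (measurableSet_cylinder z n)]
  refine (ENNReal.div_le_div_right hsum _).trans_eq ?_
  rw [← ENNReal.ofReal_div_of_pos hpos, add_div, mul_div_assoc _ (inner ℝ _ _)]
  have hQn : ‖Q‖ ≠ 0 := fun h0 => hpos.ne' (by rw [real_inner_self_eq_norm_sq, h0, sq, zero_mul])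
  congr 2
  rw [real_inner_self_eq_norm_sq]
  field_simp

theorem le_pow_mul_add {b : ℕ → ℝ≥0∞} {T : ℝ≥0∞} (hb : ∀ n, b n ≤ T * b (n + 1)) (n k : ℕ) :
    b n ≤ T ^ k * b (n + k) := by
  induction k with
  | zero => simp
  | succ k ih =>
    calc b n ≤ T ^ k * b (n + k) := ih
      _ ≤ T ^ k * (T * b (n + k + 1)) := mul_le_mul_right (hb _) _
      _ = _ := by rw [← mul_assoc, ← pow_succ, add_assoc]

theorem exists_series_startingWith_le (hs : WordsConnect τ s) (hR : IsRegularPotential R)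
    {T : ℝ≥0∞} (hT : T ≠ ∞) (a : W) (x : MarkovShift τ) (f : QuotientSum H) (A B : W) (g : G) :
    ∃ C ≠ ∞, ∀ b : ℕ → ℝ≥0∞, (∀ n, b n ≤ T * b (n + 1)) → ∀ q : Σ i, G ⧸ H i,
      series R s f b (startingWith B : Set (InverseBranch a x)) (g⁻¹ • q) ≤
        C * series R s f b (startingWith A : Set (InverseBranch a x)) q := by
  obtain ⟨r, hr, hRr⟩ := hR.exists_lower
  obtain ⟨p, k, rfl, rfl, rfl⟩ := hs A B g
  exact ⟨T ^ k * ENNReal.ofReal (r ^ k)⁻¹,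
    ENNReal.mul_ne_top (ENNReal.pow_ne_top hT) ENNReal.ofReal_ne_top,
    fun b hb q => series_startingWith_le hr hRr p k (fun n => le_pow_mul_add hb n k) q⟩

theorem exists_series_univ_le [Finite W] (hs : WordsConnect τ s) (hR : IsRegularPotential R)
    {T : ℝ≥0∞} (hT : T ≠ ∞) (a : W) (x : MarkovShift τ) (f : QuotientSum H) (A : W) :
    ∃ C ≠ ∞, ∀ b : ℕ → ℝ≥0∞, (∀ n, b n ≤ T * b (n + 1)) → ∀ q : Σ i, G ⧸ H i,
      series R s f b (Set.univ : Set (InverseBranch a x)) q ≤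
        C * series R s f b (startingWith A : Set (InverseBranch a x)) q := by
  have := Fintype.ofFinite W
  choose C hC hle using fun B => exists_series_startingWith_le hs hR hT a x f A B 1
  refine ⟨∑ B, C B, ENNReal.sum_ne_top.2 fun B _ => hC B, fun b hb q => ?_⟩
  have hcover : (Set.univ : Set (InverseBranch a x)) ⊆ ⋃ B, startingWith B := fun p _ =>
    Set.mem_iUnion.2 ⟨p.point.1 0, rfl⟩
  refine (series_mono b hcover q).trans ((ENNReal.tsum_iUnion_le (fun p : InverseBranch a x =>
    p.weight R b * ENNReal.ofReal (f ((p.value s)⁻¹ • q))) _).trans ?_)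
  rw [Finset.sum_mul]
  refine Finset.sum_le_sum fun B _ => ?_
  have hB := hle B b hb q
  rwa [inv_one, one_smul] at hB

end Approx

/-! ### Twisted limits -/

section BorelCantelli

variable {W : Type*} {τ : W → W → Prop} {G : Type*} [Group G] {s : W → G} [MeasurableSpace W]
  {ν : Measure (MarkovShift τ)} [IsFiniteMeasure ν] {Υ : G → ℝ} {j : ℕ} {C : ℝ}

theorem measure_setOf_lt_le [Finite W] (hC : 0 ≤ C) {n : ℕ} {p : MarkovShift τ → ℝ}
    (hp : ∀ z, 0 ≤ p z)
    (hν : ∀ z, ν.real (cylinder z (j + n)) ≤ C * p z * Υ (wordValue s z j n)) (ψ : G → ℝ) :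
    ν {z | Υ (wordValue s z j n) < ψ (wordValue s z j n)} ≤
      ENNReal.ofReal C * ∑' u : Words τ (j + n),
        ENNReal.ofReal (p u.rep * ψ (wordValue s u.rep j n)) := by
  set bad := {z : MarkovShift τ | Υ (wordValue s z j n) < ψ (wordValue s z j n)}
  have hcover : bad ⊆ ⋃ u : Words τ (j + n), bad ∩ cylinder u.rep (j + n) := fun z hz =>
    Set.mem_iUnion.2 ⟨wordOf z (j + n), hz, mem_cylinder_rep_wordOf z (j + n)⟩
  refine (measure_mono hcover).trans ((measure_iUnion_le _).trans ?_)
  rw [← ENNReal.tsum_mul_left]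
  refine ENNReal.tsum_le_tsum fun u => ?_
  by_cases hu : Υ (wordValue s u.rep j n) < ψ (wordValue s u.rep j n)
  · calc ν (bad ∩ cylinder u.rep (j + n)) ≤ ν (cylinder u.rep (j + n)) :=
          measure_mono Set.inter_subset_right
      _ = ENNReal.ofReal (ν.real (cylinder u.rep (j + n))) :=
          (ENNReal.ofReal_toReal (measure_ne_top ν _)).symm
      _ ≤ ENNReal.ofReal (C * (p u.rep * ψ (wordValue s u.rep j n))) := by
          refine ENNReal.ofReal_le_ofReal ((hν u.rep).trans ?_)
          rw [mul_assoc]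
          have := hp u.rep
          gcongr
      _ = _ := ENNReal.ofReal_mul hC
  · have hempty : bad ∩ cylinder u.rep (j + n) = ∅ := by
      refine Set.eq_empty_iff_forall_notMem.2 fun z ⟨hz, hzu⟩ => hu ?_
      rw [← wordValue_congr s hzu]
      exact hz
    rw [hempty, measure_empty]
    exact zero_le

theorem ae_eventually_le_of_tsum_ne_top [Finite W] (hC : 0 ≤ C)
    {p : (n : ℕ) → MarkovShift τ → ℝ} (hp : ∀ n z, 0 ≤ p n z)
    (hν : ∀ z n, ν.real (cylinder z (j + n)) ≤ C * p n z * Υ (wordValue s z j n))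
    {ψ : ℕ → G → ℝ} (hψ : ∑' n, ∑' u : Words τ (j + n),
      ENNReal.ofReal (p n u.rep * ψ n (wordValue s u.rep j n)) ≠ ∞) :
    ∀ᵐ z ∂ν, ∃ N : ℕ, ∀ n ≥ N, ψ n (wordValue s z j n) ≤ Υ (wordValue s z j n) := by
  have hsum : ∑' n, ν {z | Υ (wordValue s z j n) < ψ n (wordValue s z j n)} ≠ ∞ := by
    refine ne_top_of_le_ne_top ?_
      (ENNReal.tsum_le_tsum fun n => measure_setOf_lt_le hC (hp n) (fun z => hν z n) (ψ n))
    rw [ENNReal.tsum_mul_left]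
    exact ENNReal.mul_ne_top ENNReal.ofReal_ne_top hψ
  filter_upwards [ae_eventually_notMem hsum] with z hz
  exact (eventually_atTop.1 hz).imp fun N hN n hn => not_lt.1 (hN n hn)

end BorelCantelli

section Limit

open InverseBranch

variable {W : Type*} {τ : W → W → Prop} {G : Type*} [Group G] {I : Type*} {H : I → Subgroup G}
  {R : MarkovShift τ → ℝ} {s : W → G} {A a : W} {x : MarkovShift τ} {f : QuotientSum H}

theorem matrixCoeff_nonneg (hRpos : ∀ y, 0 < R y) (hf : InCone f) {c : ℕ → ℝ}
    (hc : ∀ n, 0 ≤ c n) {t : ℝ} (ht : 0 < t) (g : G) : 0 ≤ matrixCoeff R s A a x f c t g :=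
  have hQ := inCone_phiVec hRpos hf hc ht
  div_nonneg (inner_nonneg_of_nonneg (inCone_rho hQ g) hQ) real_inner_self_nonneg

theorem matrixCoeff_mul_le [Finite W] (hRpos : ∀ y, 0 < R y) (hf : InCone f) {c : ℕ → ℝ}
    (hc : ∀ n, 0 ≤ c n) {t : ℝ} (ht : 0 < t)
    (hfin : normSq R s f (coeff c t) (startingWith A : Set (InverseBranch a x)) ≠ ∞) {g : G}
    {C : ℝ} (hC0 : 0 ≤ C) (hC : ∀ q,
      series R s f (coeff c t) (startingWith A : Set (InverseBranch a x)) (g • q) ≤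
        ENNReal.ofReal C *
          series R s f (coeff c t) (startingWith A : Set (InverseBranch a x)) q) (h : G) :
    matrixCoeff R s A a x f c t (g * h) ≤ C * matrixCoeff R s A a x f c t h := by
  have hQ := inCone_phiVec (s := s) (A := A) (a := a) (x := x) hRpos hf hc ht
  have hin := inner_nonneg_of_nonneg (inCone_rho hQ h) hQ
  rw [matrixCoeff, matrixCoeff, ← mul_div_assoc]
  refine div_le_div_of_nonneg_right ?_ real_inner_self_nonneg
  rw [← ENNReal.ofReal_le_ofReal_iff (by positivity), ENNReal.ofReal_mul hC0,
    ofReal_inner_rho_self hQ, ofReal_inner_rho_self hQ, ← ENNReal.tsum_mul_left,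
    ← (MulAction.toPerm g).tsum_eq]
  refine ENNReal.tsum_le_tsum fun q => ?_
  simp only [MulAction.toPerm_apply, mul_inv_rev, mul_smul, inv_smul_smul,
    ofReal_phiVec_apply hRpos hf hc ht hfin]
  exact (mul_le_mul_right (hC q) _).trans_eq (mul_left_comm _ _ _)

theorem exists_continuousMap_indicator {X : Type*} [TopologicalSpace X] {S : Set X}
    (hS : IsClopen S) : ∃ F : C(X, ℝ), ∀ z, F z = S.indicator 1 z := by
  have h := (LocallyConstant.charFn ℝ hS).continuous
  rw [LocallyConstant.coe_charFn] at h
  exact ⟨⟨S.indicator 1, h⟩, fun _ => rfl⟩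

namespace IsTwistedLimit

variable [TopologicalSpace W] [MeasurableSpace W] {c t : ℕ → ℝ} {Υ : G → ℝ}
  {ν : Measure (MarkovShift τ)}

theorem tendsto_inner_phiVec (hlim : IsTwistedLimit R s A a x f c t Υ ν) :
    Tendsto (fun k => inner ℝ (phiVec R s A a x f c (t k)) (phiVec R s A a x f c (t k)))
      atTop atTop :=
  hlim.diverges.comp
    (tendsto_nhdsWithin_iff.2 ⟨hlim.tendsto_param, Eventually.of_forall hlim.lt_param⟩)

theorem tendsto_norm_phiVec (hlim : IsTwistedLimit R s A a x f c t Υ ν) :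
    Tendsto (fun k => ‖phiVec R s A a x f c (t k)‖) atTop atTop :=
  (Real.tendsto_sqrt_atTop.comp hlim.tendsto_inner_phiVec).congr fun k => by
    rw [Function.comp_apply, real_inner_self_eq_norm_sq, Real.sqrt_sq (norm_nonneg _)]

theorem exists_forall_le (hlim : IsTwistedLimit R s A a x f c t Υ ν) : ∃ T : ℝ, ∀ k, t k ≤ T :=
  hlim.tendsto_param.bddAbove_range.imp fun _ hT k => hT ⟨k, rfl⟩

theorem nonneg (hlim : IsTwistedLimit R s A a x f c t Υ ν) (hRpos : ∀ y, 0 < R y)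
    (hf : InCone f) (hγ : 0 < decayExponent R s A a x f) (g : G) : 0 ≤ Υ g :=
  ge_of_tendsto' (hlim.tendsto_coeff g) fun k =>
    matrixCoeff_nonneg hRpos hf hlim.slowlyIncreasing.nonneg (hγ.trans (hlim.lt_param k)) g

theorem tendsto_measureReal [OpensMeasurableSpace (MarkovShift τ)]
    (hlim : IsTwistedLimit R s A a x f c t Υ ν) {S : Set (MarkovShift τ)} (hS : IsClopen S) :
    Tendsto (fun k => (approxMeasure R s A a x f c (t k)).real S) atTop (𝓝 (ν.real S)) := by
  obtain ⟨F, hF⟩ := exists_continuousMap_indicator hS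
  have h := hlim.tendsto_measure F
  simp_rw [hF, integral_indicator_one hS.isOpen.measurableSet] at h
  exact h

variable [Finite W]

theorem exists_coeff_mul_le (hlim : IsTwistedLimit R s A a x f c t Υ ν)
    (hs : WordsConnect τ s) (hR : IsRegularPotential R) (hf : InCone f)
    (hγ : 0 < decayExponent R s A a x f) (g : G) :
    ∃ C : ℝ, 0 ≤ C ∧ ∀ h : G, Υ (g * h) ≤ C * Υ h := by
  have hc := hlim.slowlyIncreasing
  obtain ⟨T, hT⟩ := hlim.exists_forall_le
  obtain ⟨C, hCtop, hC⟩ :=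
    exists_series_startingWith_le hs hR (ENNReal.ofReal_ne_top (r := T)) a x f A A g⁻¹
  refine ⟨C.toReal, ENNReal.toReal_nonneg, fun h => ?_⟩
  refine le_of_tendsto_of_tendsto' (hlim.tendsto_coeff (g * h))
    ((hlim.tendsto_coeff h).const_mul C.toReal) fun k => ?_
  have htk := hlim.lt_param k
  have ht0 := hγ.trans htk
  refine matrixCoeff_mul_le hR.pos hf hc.nonneg ht0 (normSq_coeff_ne_top hR hf hc htk)
    ENNReal.toReal_nonneg (fun q => ?_) h
  have := hC _ (coeff_le_mul_succ hc ht0 (hT k)) q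
  rwa [inv_inv, ← ENNReal.ofReal_toReal hCtop] at this

variable [DiscreteTopology W] [BorelSpace W]

theorem measureReal_cylinder_le (hlim : IsTwistedLimit R s A a x f c t Υ ν)
    (hR : IsRegularPotential R) {D : ℝ} (hD : HasDistortion R D) (hf : InCone f)
    (hγ : 0 < decayExponent R s A a x f) {C : ℝ} (hC0 : 0 ≤ C)
    (hC : ∀ k q, series R s f (coeff c (t k)) (Set.univ : Set (InverseBranch a x)) q ≤
      ENNReal.ofReal C * ENNReal.ofReal (phiVec R s A a x f c (t k) q))
    (z : MarkovShift τ) (n : ℕ) :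
    ν.real (cylinder z n) ≤ 2 * (decayExponent R s A a x f ^ n)⁻¹ * (D * birkhoffProd R n z) * C *
      Υ (wordValue s z 0 n) := by
  have hc := hlim.slowlyIncreasing
  obtain ⟨N, hN⟩ := eventually_atTop.1
    ((hc.slow n).eventually_le_const (show (1 : ℝ) < 2 by norm_num))
  set γ := decayExponent R s A a x f
  let w := (∑' p : {p : InverseBranch a x | p.length ≤ N + n}, p.1.weight R (coeff c γ)).toReal
  have hw : ∑' p : {p : InverseBranch a x | p.length ≤ N + n}, p.1.weight R (coeff c γ) ≤
      ENNReal.ofReal w := (ENNReal.ofReal_toReal (tsum_weight_ne_top_of_finite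
    (fun m => coeff_ne_top c γ m) (finite_setOf_length_le (N + n)))).ge
  have hbound : Tendsto (fun k => w * ‖f‖ / ‖phiVec R s A a x f c (t k)‖ +
        2 * (t k ^ n)⁻¹ * (D * birkhoffProd R n z) * C *
          matrixCoeff R s A a x f c (t k) (wordValue s z 0 n)) atTop
      (𝓝 (0 + 2 * (γ ^ n)⁻¹ * (D * birkhoffProd R n z) * C * Υ (wordValue s z 0 n))) := by
    refine (hlim.tendsto_norm_phiVec.const_div_atTop _).add (Tendsto.mul ?_ (hlim.tendsto_coeff _))
    exact (((hlim.tendsto_param.pow n).inv₀ (by positivity)).const_mul _).mul_const _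
      |>.mul_const _
  rw [zero_add] at hbound
  refine le_of_tendsto_of_tendsto (hlim.tendsto_measureReal (isClopen_cylinder z n)) hbound ?_
  filter_upwards [hlim.tendsto_inner_phiVec.eventually_gt_atTop 0] with k hk
  have ht0 : 0 < t k := hγ.trans (hlim.lt_param k)
  have hRn := (birkhoffProd_pos hR.pos n z).le
  have hD0 : 0 ≤ D := zero_le_one.trans (hD.one_le z)
  have hm := matrixCoeff_nonneg (s := s) (A := A) (a := a) (x := x) hR.pos hf hc.nonneg ht0
    (wordValue s z 0 n)
  have hw0 : 0 ≤ w := ENNReal.toReal_nonneg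
  exact ENNReal.toReal_le_of_le_ofReal (by positivity) (approxMeasure_cylinder_le hR.pos hD hf
    hc.nonneg hγ (hlim.lt_param k).le hk hC0 (hC k) z n N
    (fun m hm => (div_le_iff₀ (hc.pos m)).1 (hN m hm)) hw0 hw)

theorem exists_measure_cylinder_le (hlim : IsTwistedLimit R s A a x f c t Υ ν)
    (hs : WordsConnect τ s) (hR : IsRegularPotential R) (hf : InCone f)
    (hγ : 0 < decayExponent R s A a x f) :
    ∃ C : ℝ, 0 ≤ C ∧ ∀ z n, ν.real (cylinder z n) ≤
      C * ((decayExponent R s A a x f ^ n)⁻¹ * birkhoffProd R n z) * Υ (wordValue s z 0 n) := by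
  have hc := hlim.slowlyIncreasing
  obtain ⟨T, hT⟩ := hlim.exists_forall_le
  obtain ⟨D, hD⟩ := hR.exists_distortion
  obtain ⟨C, hCtop, hC⟩ := exists_series_univ_le hs hR (ENNReal.ofReal_ne_top (r := T)) a x f A
  have hCk : ∀ k q, series R s f (coeff c (t k)) (Set.univ : Set (InverseBranch a x)) q ≤
      ENNReal.ofReal C.toReal * ENNReal.ofReal (phiVec R s A a x f c (t k) q) := fun k q => by
    have ht0 := hγ.trans (hlim.lt_param k)
    rw [ENNReal.ofReal_toReal hCtop, ofReal_phiVec_apply hR.pos hf hc.nonneg ht0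
      (normSq_coeff_ne_top hR hf hc (hlim.lt_param k))]
    exact hC _ (coeff_le_mul_succ hc ht0 (hT k)) q
  refine ⟨2 * D * C.toReal, mul_nonneg (mul_nonneg zero_le_two
    (zero_le_one.trans (hD.one_le x))) ENNReal.toReal_nonneg, fun z n => ?_⟩
  refine (hlim.measureReal_cylinder_le hR hD hf hγ ENNReal.toReal_nonneg hCk z n).trans_eq ?_
  ring

/- Quasi-invariance of `Υ` under left multiplication removes the first `j` letters from its
argument. -/
theorem exists_measure_cylinder_le_drop (hlim : IsTwistedLimit R s A a x f c t Υ ν)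
    (hs : WordsConnect τ s) (hR : IsRegularPotential R) (hf : InCone f)
    (hγ : 0 < decayExponent R s A a x f) (j : ℕ) :
    ∃ C : ℝ, 0 ≤ C ∧ ∀ z n, ν.real (cylinder z (j + n)) ≤
      C * ((decayExponent R s A a x f ^ (j + n))⁻¹ * birkhoffProd R (j + n) z) *
        Υ (wordValue s z j n) := by
  have hΥ := hlim.nonneg hR.pos hf hγ
  obtain ⟨C, hC0, hC⟩ := hlim.exists_measure_cylinder_le hs hR hf hγ
  choose K hK0 hK using hlim.exists_coeff_mul_le hs hR hf hγ
  have := Fintype.ofFinite (Words τ j)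
  let M := ∑ u : Words τ j, K (wordValue s u.rep 0 j)
  have hM : ∀ z : MarkovShift τ, K (wordValue s z 0 j) ≤ M := fun z => by
    have hz : z ∈ cylinder (wordOf z j).rep (0 + j) := by
      rw [zero_add]
      exact mem_cylinder_rep_wordOf z j
    rw [wordValue_congr s hz]
    exact Finset.single_le_sum (f := fun u : Words τ j => K (wordValue s u.rep 0 j))
      (fun u _ => hK0 _) (Finset.mem_univ _)
  refine ⟨C * M, mul_nonneg hC0 (Finset.sum_nonneg fun u _ => hK0 _), fun z n => ?_⟩
  have hdrop : Υ (wordValue s z 0 (j + n)) ≤ M * Υ (wordValue s z j n) := by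
    rw [wordValue_add, wordValue_shift_iterate]
    exact (hK _ _).trans (mul_le_mul_of_nonneg_right (hM z) (hΥ _))
  have hp := (birkhoffProd_pos hR.pos (j + n) z).le
  calc ν.real (cylinder z (j + n)) ≤ C * ((decayExponent R s A a x f ^ (j + n))⁻¹ *
        birkhoffProd R (j + n) z) * Υ (wordValue s z 0 (j + n)) := hC z (j + n)
    _ ≤ C * ((decayExponent R s A a x f ^ (j + n))⁻¹ * birkhoffProd R (j + n) z) *
        (M * Υ (wordValue s z j n)) := by gcongr
    _ = _ := by ring

end IsTwistedLimit

end Limit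

/-! ### Series over all words -/

section WordSeries

open InverseBranch

variable {W : Type*} {τ : W → W → Prop} {G : Type*} [Group G] {I : Type*} {H : I → Subgroup G}
  {R : MarkovShift τ → ℝ} {s : W → G} {A a : W} {x : MarkovShift τ} {f : QuotientSum H}

/-- The term `b_m R_m(u) f(s(u)⁻¹ q)` of a word `u` of length `m`, in which `R_m(u)` is evaluated at
the chosen point that starts with `u`. -/
def wordTerm (R : MarkovShift τ → ℝ) (s : W → G) (f : QuotientSum H) (b : ℕ → ℝ≥0∞)
    (q : Σ i, G ⧸ H i) (w : Σ m, Words τ m) : ℝ≥0∞ :=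
  b w.1 * ENNReal.ofReal (birkhoffProd R w.1 w.2.rep) *
    ENNReal.ofReal (f ((wordValue s w.2.rep 0 w.1)⁻¹ • q))

/- A word ending in front of the first letter of a branch `p` of trivial value is continued by `p`;
this does not change the value of the word. -/
theorem tsum_wordTerm_le_mul_series {r : ℝ} (hr : 0 < r) (hRr : ∀ y, r ≤ R y) {D : ℝ}
    (hD : HasDistortion R D) {E : W} {p : InverseBranch a x} (hE : p ∈ startingWith E)
    (hp : p.value s = 1) {b : ℕ → ℝ≥0∞} {K : ℝ≥0∞} (hb : ∀ n, b n ≤ K * b (n + p.length))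
    (q : Σ i, G ⧸ H i) :
    ∑' w : {w : Σ m, Words τ m // w.2.rep.1 w.1 = E}, wordTerm R s f b q w.1 ≤
      K * ENNReal.ofReal (D * (r ^ p.length)⁻¹) *
        series R s f b (Set.univ : Set (InverseBranch a x)) q := by
  obtain rfl : p.point.1 0 = E := hE
  let e (w : {w : Σ m, Words τ m // w.2.rep.1 w.1 = p.point.1 0}) :
      (Set.univ : Set (InverseBranch a x)) := ⟨p.prepend w.1.2.rep w.1.1 w.2, trivial⟩
  have hmem w : (e w).1.point ∈ cylinder w.1.2.rep w.1.1 := prepend_point_mem_cylinder w.2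
  have he : Function.Injective e := by
    rintro ⟨⟨m, u⟩, hu⟩ ⟨⟨m', u'⟩, hu'⟩ h
    obtain rfl : m = m' := Nat.add_left_cancel (congrArg (fun p => p.1.length) h)
    obtain rfl : u = u' := Words.ext_rep fun i hi => by
      rw [← hmem ⟨⟨m, u⟩, hu⟩ i hi, ← hmem ⟨⟨m, u'⟩, hu'⟩ i hi, h]
    rfl
  refine tsum_le_mul_tsum_of_injective he fun w => ?_
  have hD0 : 0 ≤ D := zero_le_one.trans (hD.one_le x)
  have hprod : birkhoffProd R w.1.1 w.1.2.rep ≤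
      D * (r ^ p.length)⁻¹ * birkhoffProd R (e w).1.length (e w).1.point := by
    have h := birkhoffProd_le_of_mem_cylinder_shift (k := 0) (l := p.length) hr hRr hD
      (fun i hi => (hmem w i hi).symm)
    rwa [Nat.zero_add, Nat.zero_add, Nat.add_comm] at h
  have hweight : b w.1.1 * ENNReal.ofReal (birkhoffProd R w.1.1 w.1.2.rep) ≤
      K * ENNReal.ofReal (D * (r ^ p.length)⁻¹) * (e w).1.weight R b := calc
    _ ≤ (K * b (e w).1.length) * ENNReal.ofReal (D * (r ^ p.length)⁻¹ *
          birkhoffProd R (e w).1.length (e w).1.point) := by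
        gcongr
        rw [show (e w).1.length = w.1.1 + p.length from Nat.add_comm _ _]
        exact hb _
    _ = K * ENNReal.ofReal (D * (r ^ p.length)⁻¹) *
          (b (e w).1.length *
            ENNReal.ofReal (birkhoffProd R (e w).1.length (e w).1.point)) := by
        rw [ENNReal.ofReal_mul (by positivity)]
        ring
  rw [value_eq_mul_of_mem_cylinder s (hmem w) (shift_iterate_prepend_point w.2) rfl, hp, mul_one,
    wordTerm, ← mul_assoc]
  exact mul_le_mul_left hweight _

theorem exists_tsum_wordTerm_le [Finite W] (hs : WordsConnect τ s) (hR : IsRegularPotential R)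
    (hx : τ a (x.1 0)) {b : ℕ → ℝ≥0∞} {T : ℝ≥0∞} (hT : T ≠ ∞) (hb : ∀ n, b n ≤ T * b (n + 1))
    (f : QuotientSum H) (A : W) :
    ∃ C ≠ ∞, ∀ q : Σ i, G ⧸ H i, ∑' w : Σ m, Words τ m, wordTerm R s f b q w ≤
      C * series R s f b (startingWith A : Set (InverseBranch a x)) q := by
  cases nonempty_fintype W
  obtain ⟨r, hr, hRr⟩ := hR.exists_lower
  obtain ⟨D, hD⟩ := hR.exists_distortion
  obtain ⟨K, hK, hle⟩ := exists_series_univ_le hs hR hT a x f A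
  choose p hp hval using fun E => exists_mem_startingWith_value_eq hs hx E 1
  let C : W → ℝ≥0∞ := fun E => T ^ (p E).length * ENNReal.ofReal (D * (r ^ (p E).length)⁻¹)
  refine ⟨(∑ E, C E) * K, ENNReal.mul_ne_top (ENNReal.sum_ne_top.2 fun E _ =>
    ENNReal.mul_ne_top (ENNReal.pow_ne_top hT) ENNReal.ofReal_ne_top) hK, fun q => ?_⟩
  calc ∑' w : Σ m, Words τ m, wordTerm R s f b q w
      = ∑ E, ∑' w : {w : Σ m, Words τ m // w.2.rep.1 w.1 = E}, wordTerm R s f b q w.1 := by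
        rw [← ENNReal.tsum_fiberwise _ fun w : Σ m, Words τ m => w.2.rep.1 w.1, tsum_fintype]
        rfl
    _ ≤ ∑ E, C E * series R s f b (Set.univ : Set (InverseBranch a x)) q :=
        Finset.sum_le_sum fun E _ => tsum_wordTerm_le_mul_series hr hRr hD (hp E) (hval E)
          (fun n => le_pow_mul_add hb n _) q
    _ ≤ ∑ E, C E * (K * series R s f b (startingWith A : Set (InverseBranch a x)) q) := by
        gcongr
        exact hle b hb q
    _ = _ := by rw [← Finset.sum_mul, mul_assoc]

theorem tsum_words_inner_eq (hRpos : ∀ y, 0 < R y) (hf : InCone f) {v : QuotientSum H}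
    (hv : InCone v) {t : ℝ} (ht : 0 < t) :
    ∑' m, ∑' u : Words τ m, ENNReal.ofReal ((t ^ m)⁻¹ * birkhoffProd R m u.rep *
        inner ℝ (rho H (wordValue s u.rep 0 m) f) v) =
      ∑' q, (∑' w, wordTerm R s f (coeff (fun _ => 1) t) q w) * ENNReal.ofReal (v q) := by
  simp_rw [← ENNReal.tsum_mul_right]
  rw [ENNReal.tsum_comm, ENNReal.tsum_sigma']
  refine tsum_congr fun m => tsum_congr fun u => ?_
  have hp := (birkhoffProd_pos hRpos m u.rep).le
  rw [ENNReal.ofReal_mul (by positivity), ENNReal.ofReal_mul (by positivity),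
    ofReal_inner_eq_tsum (inCone_rho hf _) hv, ← ENNReal.tsum_mul_left]
  refine tsum_congr fun q => ?_
  rw [wordTerm, coeff, mul_one, rho_apply]
  ring

theorem tsum_words_inner_ne_top [Finite W] (hs : WordsConnect τ s) (hR : IsRegularPotential R)
    (hx : τ a (x.1 0)) (hf : InCone f) {t : ℝ} (ht : 0 < t)
    (hlt : decayExponent R s A a x f < t) {v : QuotientSum H} (hv : InCone v) :
    ∑' m, ∑' u : Words τ m, ENNReal.ofReal ((t ^ m)⁻¹ * birkhoffProd R m u.rep *
      inner ℝ (rho H (wordValue s u.rep 0 m) f) v) ≠ ∞ := by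
  have h1 := slowlyIncreasing_one
  obtain ⟨C, hC, hle⟩ := exists_tsum_wordTerm_le hs hR hx (ENNReal.ofReal_ne_top (r := t))
    (coeff_le_mul_succ h1 ht le_rfl) f A
  have hbound : ∑' q, (∑' w, wordTerm R s f (coeff (fun _ => 1) t) q w) * ENNReal.ofReal (v q) ≤
      C * ENNReal.ofReal (inner ℝ (phiVec R s A a x f (fun _ => 1) t) v) := by
    rw [ofReal_inner_eq_tsum (inCone_phiVec hR.pos hf h1.nonneg ht) hv, ← ENNReal.tsum_mul_left]
    refine ENNReal.tsum_le_tsum fun q => ?_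
    rw [ofReal_phiVec_apply hR.pos hf h1.nonneg ht (normSq_coeff_ne_top hR hf h1 hlt), ← mul_assoc]
    exact mul_le_mul_left (hle q) _
  rw [tsum_words_inner_eq hR.pos hf hv ht]
  exact ne_top_of_le_ne_top (ENNReal.mul_ne_top hC ENNReal.ofReal_ne_top) hbound

/- Dropping the first `j` letters `e` replaces `v` by `ρ(s(e)) v`, and all of these vectors are
dominated by their finite sum over `e`. -/
theorem tsum_words_inner_drop_ne_top [Finite W] (hs : WordsConnect τ s)
    (hR : IsRegularPotential R) (hx : τ a (x.1 0)) (hf : InCone f) {t : ℝ} (ht : 0 < t)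
    (hlt : decayExponent R s A a x f < t) {v : QuotientSum H} (hv : InCone v) (j : ℕ) :
    ∑' n, ∑' u : Words τ (j + n), ENNReal.ofReal ((t ^ (j + n))⁻¹ * birkhoffProd R (j + n) u.rep *
      inner ℝ (rho H (wordValue s u.rep j n) f) v) ≠ ∞ := by
  have := Fintype.ofFinite (Words τ j)
  let v' : QuotientSum H := ∑ e : Words τ j, rho H (wordValue s e.rep 0 j) v
  have hv' : InCone v' := fun q => by
    simp only [v', lp.coeFn_sum, Finset.sum_apply]
    exact Finset.sum_nonneg fun e _ => inCone_rho hv _ q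
  have hinner : ∀ (z : MarkovShift τ) (n : ℕ), inner ℝ (rho H (wordValue s z j n) f) v ≤
      inner ℝ (rho H (wordValue s z 0 (j + n)) f) v' := fun z n => by
    have hz : z ∈ cylinder (wordOf z j).rep (0 + j) := by
      rw [zero_add]
      exact mem_cylinder_rep_wordOf z j
    rw [wordValue_add, wordValue_shift_iterate, map_mul,
      ← LinearIsometryEquiv.inner_map_map (rho H (wordValue s z 0 j)) _ v, wordValue_congr s hz]
    simp only [v', inner_sum]
    exact Finset.single_le_sum
      (f := fun e : Words τ j => inner ℝ _ (rho H (wordValue s e.rep 0 j) v))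
      (fun e _ => inner_nonneg_of_nonneg (inCone_rho (inCone_rho hf _) _) (inCone_rho hv _))
      (Finset.mem_univ _)
  refine ne_top_of_le_ne_top (tsum_words_inner_ne_top hs hR hx hf ht hlt hv') ?_
  refine le_trans ?_ (ENNReal.tsum_comp_le_tsum_of_injective (add_right_injective j)
    fun m => ∑' u : Words τ m, ENNReal.ofReal ((t ^ m)⁻¹ * birkhoffProd R m u.rep *
      inner ℝ (rho H (wordValue s u.rep 0 m) f) v'))
  refine ENNReal.tsum_le_tsum fun n => ENNReal.tsum_le_tsum fun u => ENNReal.ofReal_le_ofReal ?_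
  have hp := (birkhoffProd_pos hR.pos (j + n) u.rep).le
  exact mul_le_mul_of_nonneg_left (hinner u.rep n) (by positivity)

end WordSeries

/-! ### Existence of twisted limits -/

section Compactness

variable {X : Type*} [TopologicalSpace X] [CompactSpace X] [TopologicalSpace.MetrizableSpace X]
  [MeasurableSpace X] [BorelSpace X]

theorem exists_subseq_tendsto_integral {ι : Type*} [Countable ι] {u : ℕ → ι → ℝ}
    (hu : ∀ k i, |u k i| ≤ 1) {μ : ℕ → Measure X} {C : ℝ≥0∞} (hC : C ≠ ∞)
    (hμ : ∀ k, μ k Set.univ ≤ C) (hμ0 : ∀ k, μ k ≠ 0) :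
    ∃ (κ : ℕ → ℕ) (v : ι → ℝ) (ν : Measure X), StrictMono κ ∧ IsFiniteMeasure ν ∧
      (∀ i, Tendsto (fun k => u (κ k) i) atTop (𝓝 (v i))) ∧
      ∀ F : C(X, ℝ), Tendsto (fun k => ∫ z, F z ∂(μ (κ k))) atTop (𝓝 (∫ z, F z ∂ν)) := by
  let : MetricSpace X := TopologicalSpace.metrizableSpaceMetric X
  have (k : ℕ) : IsFiniteMeasure (μ k) := ⟨(hμ k).trans_lt hC.lt_top⟩
  have (k : ℕ) : NeZero (μ k) := ⟨hμ0 k⟩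
  let P (k : ℕ) : ProbabilityMeasure X := ⟨(μ k Set.univ)⁻¹ • μ k, inferInstance⟩
  have hK : IsCompact ((Set.univ.pi fun _ : ι => Set.Icc (-1 : ℝ) 1) ×ˢ
      ((Set.univ : Set (ProbabilityMeasure X)) ×ˢ Set.Icc (0 : ℝ) C.toReal)) :=
    (isCompact_univ_pi fun _ => isCompact_Icc).prod (isCompact_univ.prod isCompact_Icc)
  obtain ⟨⟨v, Q, m⟩, hm, κ, hκ, hlim⟩ := hK.tendsto_subseq
    (x := fun k => (u k, P k, (μ k).real Set.univ)) fun k =>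
      ⟨fun i _ => abs_le.1 (hu k i), Set.mem_univ _, measureReal_nonneg,
        ENNReal.toReal_mono hC (hμ k)⟩
  simp only [nhds_prod_eq, tendsto_prod_iff'] at hlim
  obtain ⟨hv, hP, hmass⟩ := hlim
  refine ⟨κ, v, ENNReal.ofReal m • (Q : Measure X), hκ, Measure.smul_finite _ ENNReal.ofReal_ne_top,
    tendsto_pi_nhds.1 hv, fun F => ?_⟩
  have hF := hmass.mul (ProbabilityMeasure.tendsto_iff_forall_integral_tendsto.1 hP
    (BoundedContinuousFunction.mkOfCompact F))
  rw [integral_smul_measure, ENNReal.toReal_ofReal hm.2.2.1]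
  refine hF.congr fun k => ?_
  change (μ (κ k)).real Set.univ * ∫ z, F z ∂((μ (κ k) Set.univ)⁻¹ • μ (κ k)) = _
  rw [integral_smul_measure, ENNReal.toReal_inv, smul_eq_mul]
  exact mul_inv_cancel_left₀ measureReal_univ_ne_zero _

end Compactness

section Existence

open InverseBranch

variable {W : Type*} {τ : W → W → Prop} {G : Type*} [Group G] {I : Type*} {H : I → Subgroup G}
  {R : MarkovShift τ → ℝ} {s : W → G} {A a : W} {x : MarkovShift τ} {f : QuotientSum H}

theorem abs_matrixCoeff_le_one (c : ℕ → ℝ) (t : ℝ) (g : G) :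
    |matrixCoeff R s A a x f c t g| ≤ 1 := by
  rw [matrixCoeff, abs_div, abs_of_nonneg real_inner_self_nonneg]
  refine div_le_one_of_le₀ ((abs_real_inner_le_norm _ _).trans ?_) real_inner_self_nonneg
  rw [LinearIsometryEquiv.norm_map, real_inner_self_eq_norm_mul_norm]

theorem approxMeasure_univ_le [Finite W] [MeasurableSpace W] (hR : IsRegularPotential R)
    (hf : InCone f) {c : ℕ → ℝ} (hc : SlowlyIncreasing c) {t : ℝ} (ht : 0 < t)
    (hlt : decayExponent R s A a x f < t)
    (hpos : 0 < inner ℝ (phiVec R s A a x f c t) (phiVec R s A a x f c t)) {C : ℝ≥0∞}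
    (hC : ∀ q, series R s f (coeff c t) (Set.univ : Set (InverseBranch a x)) q ≤
      C * series R s f (coeff c t) (startingWith A : Set (InverseBranch a x)) q) :
    approxMeasure R s A a x f c t Set.univ ≤ C := by
  have hfin := normSq_coeff_ne_top hR hf hc hlt
  rw [approxMeasure_apply hR.pos hf hc.nonneg ht hpos MeasurableSet.univ,
    ofReal_inner_phiVec hR.pos hf hc.nonneg ht hfin]
  simp_rw [ofReal_phiVec_apply hR.pos hf hc.nonneg ht hfin]
  exact ENNReal.div_le_of_le_mul (tsum_mul_le_mul_tsum_sq hC)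

theorem approxMeasure_letter [Finite W] [MeasurableSpace W] [MeasurableSingletonClass W]
    (hR : IsRegularPotential R) (hf : InCone f) {c : ℕ → ℝ} (hc : SlowlyIncreasing c) {t : ℝ}
    (ht : 0 < t) (hlt : decayExponent R s A a x f < t)
    (hpos : 0 < inner ℝ (phiVec R s A a x f c t) (phiVec R s A a x f c t)) :
    approxMeasure R s A a x f c t {y | y.1 0 = A} = 1 := by
  have hA : MeasurableSet {y : MarkovShift τ | y.1 0 = A} :=
    measurable_letter 0 (measurableSet_singleton A)
  have hfin := normSq_coeff_ne_top hR hf hc hlt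
  have h0 := (ENNReal.ofReal_pos.2 hpos).ne'
  rw [approxMeasure_apply hR.pos hf hc.nonneg ht hpos hA]
  simp_rw [ofReal_phiVec_apply hR.pos hf hc.nonneg ht hfin]
  rw [ofReal_inner_phiVec hR.pos hf hc.nonneg ht hfin] at h0 ⊢
  simp_rw [normSq, sq] at h0 hfin ⊢
  exact ENNReal.div_self h0 hfin

theorem exists_isTwistedLimit [TopologicalSpace W] [DiscreteTopology W] [MeasurableSpace W]
    [BorelSpace W] [CompactSpace (MarkovShift τ)] [Finite W] [Countable G]
    (hs : WordsConnect τ s) (hR : IsRegularPotential R) (hf : InCone f)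
    (hγ : 0 < decayExponent R s A a x f) :
    ∃ (c : ℕ → ℝ) (t : ℕ → ℝ) (Υ : G → ℝ) (ν : Measure (MarkovShift τ)),
      IsTwistedLimit R s A a x f c t Υ ν := by
  obtain ⟨c, hc, htop⟩ := exists_slowlyIncreasing_normSq_eq_top (s := s) (A := A) (a := a) (x := x)
    hR.pos hf hγ
  have hdiv := tendsto_inner_phiVec_atTop (s := s) (A := A) (a := a) (x := x) hR hf hc hγ htop
  let γ := decayExponent R s A a x f
  obtain ⟨t, -, ht, htγ⟩ := exists_seq_strictAnti_tendsto' (lt_add_one γ)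
  have htγ' : Tendsto t atTop (𝓝[>] γ) :=
    tendsto_nhdsWithin_iff.2 ⟨htγ, Eventually.of_forall fun k => (ht k).1⟩
  obtain ⟨k₀, hk₀⟩ := eventually_atTop.1 ((hdiv.comp htγ').eventually_gt_atTop 0)
  have hpos (k : ℕ) : 0 < t (k + k₀) := hγ.trans (ht _).1
  have hnorm (k : ℕ) := hk₀ (k + k₀) (Nat.le_add_left _ _)
  obtain ⟨C, hCtop, hC⟩ :=
    exists_series_univ_le hs hR (ENNReal.ofReal_ne_top (r := γ + 1)) a x f A
  have : TopologicalSpace.MetrizableSpace (MarkovShift τ) :=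
    have := TopologicalSpace.metrizableSpace_of_t3_secondCountable (ℕ → W)
    IsEmbedding.subtypeVal.metrizableSpace
  have hmass (k : ℕ) : approxMeasure R s A a x f c (t (k + k₀)) Set.univ ≤ C :=
    approxMeasure_univ_le hR hf hc (hpos k) (ht _).1 (hnorm k)
      (hC _ (coeff_le_mul_succ hc (hpos k) (ht _).2.le))
  have hne (k : ℕ) : approxMeasure R s A a x f c (t (k + k₀)) ≠ 0 := fun h0 => by
    have h1 := approxMeasure_letter hR hf hc (hpos k) (ht _).1 (hnorm k)
    rw [h0] at h1
    exact zero_ne_one h1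
  obtain ⟨κ, Υ, ν, hκ, hν, hcoeff, hmeas⟩ := exists_subseq_tendsto_integral
    (u := fun k => matrixCoeff R s A a x f c (t (k + k₀)))
    (fun k g => abs_matrixCoeff_le_one c _ g) hCtop hmass hne
  exact ⟨c, fun k => t (κ k + k₀), Υ, ν, hc, hdiv, fun k => (ht _).1,
    (htγ.comp (tendsto_add_atTop_nat k₀)).comp hκ.tendsto_atTop, hcoeff, hν, hmeas⟩

end Existence

/-! ### Almost sure lower bounds for the matrix coefficient -/

section LowerBound

variable {W : Type*} {τ : W → W → Prop} {G : Type*} [Group G] {I : Type*} {H : I → Subgroup G}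
  {R : MarkovShift τ → ℝ} {s : W → G} {A a : W} {x : MarkovShift τ} {f : QuotientSum H}

theorem tsum_words_inv_sq_mul_ne_top [Finite W] (hs : WordsConnect τ s)
    (hR : IsRegularPotential R) {B : W} (hP : gurevicPressure R B ≤ 0) {t : ℝ} (ht : 0 < t)
    (j : ℕ) :
    ∑' n : ℕ, ∑' u : Words τ (j + n), ENNReal.ofReal ((t ^ (j + n))⁻¹ *
      birkhoffProd R (j + n) u.rep * (((n : ℝ) ^ 2)⁻¹ * t ^ n)) ≠ ∞ := by
  obtain ⟨K, hK, hle⟩ := exists_tsum_words_birkhoffProd_le hs hR hP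
  have hterm (n : ℕ) : ∑' u : Words τ (j + n), ENNReal.ofReal ((t ^ (j + n))⁻¹ *
      birkhoffProd R (j + n) u.rep * (((n : ℝ) ^ 2)⁻¹ * t ^ n)) ≤
      ENNReal.ofReal ((t ^ j)⁻¹ * ((n : ℝ) ^ 2)⁻¹) * K := by
    have hfactor (u : Words τ (j + n)) : (t ^ (j + n))⁻¹ * birkhoffProd R (j + n) u.rep *
        (((n : ℝ) ^ 2)⁻¹ * t ^ n) =
        (t ^ j)⁻¹ * ((n : ℝ) ^ 2)⁻¹ * birkhoffProd R (j + n) u.rep := by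
      rw [pow_add, mul_inv]
      field_simp
    rcases n.eq_zero_or_pos with rfl | hn
    · simp
    · simp_rw [hfactor, ENNReal.ofReal_mul (show 0 ≤ (t ^ j)⁻¹ * ((n : ℝ) ^ 2)⁻¹ by positivity)]
      rw [ENNReal.tsum_mul_left]
      exact mul_le_mul_right (hle _ (by omega)) _
  refine ne_top_of_le_ne_top ?_ (ENNReal.tsum_le_tsum hterm)
  rw [ENNReal.tsum_mul_right, ← ENNReal.ofReal_tsum_of_nonneg (fun n => by positivity)
    ((Real.summable_nat_pow_inv.2 one_lt_two).mul_left _)]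
  exact ENNReal.mul_ne_top ENNReal.ofReal_ne_top hK

namespace IsTwistedLimit

variable [TopologicalSpace W] [MeasurableSpace W] [Finite W] [DiscreteTopology W] [BorelSpace W]
  {c : ℕ → ℝ} {t : ℕ → ℝ} {Υ : G → ℝ} {ν : Measure (MarkovShift τ)}

theorem ae_eventually_le_coeff (hlim : IsTwistedLimit R s A a x f c t Υ ν)
    (hs : WordsConnect τ s) (hR : IsRegularPotential R) (hf : InCone f)
    (hγ : 0 < decayExponent R s A a x f) (j : ℕ) {ψ : ℕ → G → ℝ}
    (hψ : ∑' n, ∑' u : Words τ (j + n), ENNReal.ofReal ((decayExponent R s A a x f ^ (j + n))⁻¹ *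
      birkhoffProd R (j + n) u.rep * ψ n (wordValue s u.rep j n)) ≠ ∞) :
    ∀ᵐ z ∂ν, ∃ N : ℕ, ∀ n ≥ N, ψ n (wordValue s z j n) ≤ Υ (wordValue s z j n) := by
  have := hlim.finite
  obtain ⟨C, hC, hle⟩ := hlim.exists_measure_cylinder_le_drop hs hR hf hγ j
  exact ae_eventually_le_of_tsum_ne_top hC
    (fun n z => mul_nonneg (by positivity) (birkhoffProd_pos hR.pos _ _).le) hle hψ

theorem ae_eventually_inner_le_inv_pow_mul_coeff (hlim : IsTwistedLimit R s A a x f c t Υ ν)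
    (hs : WordsConnect τ s) (hR : IsRegularPotential R) (hx : τ a (x.1 0)) (hf : InCone f)
    (hγ : 0 < decayExponent R s A a x f) (j : ℕ) {ε : ℝ} (hε0 : 0 < ε) (hε1 : ε < 1)
    {v : QuotientSum H} (hv : InCone v) :
    ∀ᵐ z ∂ν, ∃ N : ℕ, ∀ n ≥ N, inner ℝ (rho H (wordValue s z j n) f) v ≤
      ((1 - ε) ^ n)⁻¹ * Υ (wordValue s z j n) := by
  have hδ : 0 < 1 - ε := sub_pos.2 hε1
  have hlt : decayExponent R s A a x f < decayExponent R s A a x f / (1 - ε) :=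
    (lt_div_iff₀ hδ).2 (mul_lt_of_lt_one_right hγ (sub_lt_self 1 hε0))
  have hsum := tsum_words_inner_drop_ne_top hs hR hx hf (hγ.trans hlt) hlt hv j
  have hae := hlim.ae_eventually_le_coeff hs hR hf hγ j
    (ψ := fun n g => (1 - ε) ^ n * inner ℝ (rho H g f) v) (by
      refine ne_top_of_le_ne_top
        (ENNReal.mul_ne_top (ENNReal.ofReal_ne_top (r := ((1 - ε) ^ j)⁻¹)) hsum) ?_
      simp_rw [← ENNReal.tsum_mul_left]
      refine ENNReal.tsum_le_tsum fun n => ENNReal.tsum_le_tsum fun u => ?_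
      rw [← ENNReal.ofReal_mul (by positivity)]
      refine (congrArg ENNReal.ofReal ?_).le
      rw [div_pow, inv_div, pow_add (1 - ε)]
      field_simp)
  filter_upwards [hae] with z ⟨N, hN⟩
  exact ⟨N, fun n hn => (le_inv_mul_iff₀ (by positivity)).2 (hN n hn)⟩

theorem ae_eventually_inv_sq_mul_pow_le_coeff (hlim : IsTwistedLimit R s A a x f c t Υ ν)
    (hs : WordsConnect τ s) (hR : IsRegularPotential R) {B : W} (hP : gurevicPressure R B ≤ 0)
    (hf : InCone f) (hγ : 0 < decayExponent R s A a x f) (j : ℕ) :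
    ∀ᵐ z ∂ν, ∃ N : ℕ, ∀ n ≥ N,
      ((n : ℝ) ^ 2)⁻¹ * decayExponent R s A a x f ^ n ≤ Υ (wordValue s z j n) :=
  hlim.ae_eventually_le_coeff hs hR hf hγ j
    (ψ := fun n _ => ((n : ℝ) ^ 2)⁻¹ * decayExponent R s A a x f ^ n)
    (tsum_words_inv_sq_mul_ne_top hs hR hP hγ j)

end IsTwistedLimit

end LowerBound

end

end TwistedDecay

theorem mainTheorem8_general
    {W : Type*} [TopologicalSpace W] [DiscreteTopology W] [MeasurableSpace W] [BorelSpace W]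
    (τ : W → W → Prop) [CompactSpace (MarkovShift τ)]
    (hlive : ∀ B : W, ∃ y : MarkovShift τ, y.1 0 = B)
    (R : MarkovShift τ → ℝ) (hRpos : ∀ y, 0 < R y)
    (hR : LocallyHolder fun y => Real.log (R y))
    {B : W} (hP : gurevicPressure R B ≤ 0)
    {G : Type*} [Group G] (s : W → G)
    (htrans : IsTransitiveSkew τ s)
    {I : Type*} (H : I → Subgroup G)
    (A a : W) (x : MarkovShift τ) (hx : τ a (x.1 0))
    (f : QuotientSum H) (hf : InCone f) (hf0 : f ≠ 0) :
    (∃ (c : ℕ → ℝ) (t : ℕ → ℝ) (Υ : G → ℝ) (ν : Measure (MarkovShift τ)),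
      IsTwistedLimit R s A a x f c t Υ ν) ∧
    ∀ (c : ℕ → ℝ) (t : ℕ → ℝ) (Υ : G → ℝ) (ν : Measure (MarkovShift τ)),
      IsTwistedLimit R s A a x f c t Υ ν →
      ∀ j : ℕ,
        (∀ ε : ℝ, 0 < ε → ε < 1 → ∀ v : QuotientSum H, InCone v →
          ∀ᵐ z ∂ν, ∃ N : ℕ, ∀ n ≥ N,
            inner ℝ (rho H (wordValue s z j n) f) v ≤
              ((1 - ε) ^ n)⁻¹ * Υ (wordValue s z j n)) ∧
        (∀ᵐ z ∂ν, ∃ N : ℕ, ∀ n ≥ N,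
          ((n : ℝ) ^ 2)⁻¹ * decayExponent R s A a x f ^ n ≤ Υ (wordValue s z j n)) := by
  have : Finite W := finite_alphabet hlive
  have : Nonempty W := ⟨a⟩
  have hs := htrans.wordsConnect hlive
  have := hs.countable
  have hreg := hR.isRegularPotential hRpos
  have hγ := decayExponent_pos (A := A) hs hx hreg hf hf0
  exact ⟨exists_isTwistedLimit hs hreg hf hγ, fun c t Υ ν hlim j =>
    ⟨fun ε hε0 hε1 v hv =>
      hlim.ae_eventually_inner_le_inv_pow_mul_coeff hs hreg hx hf hγ j hε0 hε1 hv,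
    hlim.ae_eventually_inv_sq_mul_pow_le_coeff hs hreg hP hf hγ j⟩⟩

theorem mainTheorem8
    {W : Type*} [Countable W] [TopologicalSpace W] [DiscreteTopology W]
    [MeasurableSpace W] [BorelSpace W]
    (τ : W → W → Prop) [CompactSpace (MarkovShift τ)]
    (hlive : ∀ B : W, ∃ y : MarkovShift τ, y.1 0 = B)
    (hmix : IsMixing τ)
    (R : MarkovShift τ → ℝ) (hRpos : ∀ y, 0 < R y)
    (hR : LocallyHolder fun y => Real.log (R y))
    (hP : ∀ B : W, gurevicPressure R B = 0)
    {G : Type*} [Group G] [Countable G] (s : W → G)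
    (htrans : IsTransitiveSkew τ s)
    {I : Type*} [Countable I] (H : I → Subgroup G)
    (A a : W) (x : MarkovShift τ) (hx : τ a (x.1 0))
    (f : QuotientSum H) (hf : InCone f) (hf0 : f ≠ 0)
    (hγ : decayExponent R s A a x f < 1) :
    (∃ (c : ℕ → ℝ) (t : ℕ → ℝ) (Υ : G → ℝ) (ν : MeasureTheory.Measure (MarkovShift τ)),
      IsTwistedLimit R s A a x f c t Υ ν) ∧
    ∀ (c : ℕ → ℝ) (t : ℕ → ℝ) (Υ : G → ℝ) (ν : MeasureTheory.Measure (MarkovShift τ)),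
      IsTwistedLimit R s A a x f c t Υ ν →
      ∀ j : ℕ, j ≤ 1 →
        (∀ ε : ℝ, 0 < ε → ε < 1 → ∀ v : QuotientSum H, InCone v →
          ∀ᵐ z ∂ν, ∃ N : ℕ, ∀ n ≥ N,
            inner ℝ (rho H (wordValue s z j n) f) v ≤
              ((1 - ε) ^ n)⁻¹ * Υ (wordValue s z j n)) ∧
        (∀ᵐ z ∂ν, ∃ N : ℕ, ∀ n ≥ N,
          ((n : ℝ) ^ 2)⁻¹ * decayExponent R s A a x f ^ n ≤ Υ (wordValue s z j n)) := by
  obtain ⟨hexists, hbounds⟩ := mainTheorem8_general τ hlive R hRpos hR (hP a).le s htrans H A a x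
    hx f hf hf0
  exact ⟨hexists, fun c t Υ ν hlim j _ => hbounds c t Υ ν hlim j⟩
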